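/- Over $\mathsf{RCA}_0$ (that is, in every model $M=(|M|,\mathcal S,+,\cdot,0,1,<)$ of $\mathsf{RCA}_0$, where $|M|$ may be nonstandard and the set variables range over a nonempty family $\mathcal S$ of subsets of $|M|$; by the completeness theorem this is the same as provability in $\mathsf{RCA}_0$), the following are equivalent: 1. $\mathsf{WKL}_0$, i.e. every infinite tree $T\subseteq 2^{<\mathbb N}$ has a path; 2. if a partial order $P$ contains an infinite antichain $D$, then $P$ has an initial interval $I$ such that $D\subseteq I$ and $(\forall x\in D)(\forall y\in I)\; x\nprec y$; 3. if a partial order $P$ contains an infinite antichain $D$, then $P$ has an initial interval $I$ such that $I\cap D$ is infinite and $(\forall x\in D)(\forall y\in I)\; x\nprec y$. Here a partial order consists of a set $P\subseteq\mathbb N$ and a reflexive, antisymmetric and transitive relation ${\preceq}\subseteq P\times P$; $x\prec y$ means $x\preceq y$ and $x\neq y$; an antichain is a set $D\subseteq P$ whose distinct elements are pairwise incomparable; an initial interval is a set $I\subseteq P$ such that $x\preceq y$ and $y\in I$ imply $x\in I$ for all $x,y\in P$. -/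

import Mathlib

universe u

/-- A structure for the (two-sorted) language of second order arithmetic: a domain of numbers with
`0, 1, +, ·, <`, and a nonempty family of subsets of this domain over which the set variables range.
The domain of numbers is arbitrary (it may be nonstandard) and so is the family of sets. -/
structure L2Structure where
  /-- the domain of the number variables -/
  Num : Type u
  /-- the domain of the set variables -/
  sets : Set (Set Num)
  sets_nonempty : sets.Nonempty
  zero : Num
  one : Num
  add : Num → Num → Num
  mul : Num → Num → Num
  lt : Num → Num → Prop

/-! ### Syntax: numerical terms and bounded formulas

Number variables are de Bruijn indices, set variables are names `0, 1, 2, …`. Formulas have no set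
quantifiers; set variables occur free, as parameters. -/

/-- Numerical terms. -/
inductive L2Term : Type
  | var (i : ℕ) : L2Term
  | zero : L2Term
  | one : L2Term
  | add (s t : L2Term) : L2Term
  | mul (s t : L2Term) : L2Term

/-- Bounded formulas (all number quantifiers are bounded by terms, no set quantifiers). The
quantifiers `bdAll t φ` (for `∀ x < t, φ`) and `bdEx t φ` (for `∃ x < t, φ`) bind variable `0` of
`φ`; the bound `t` is outside their scope. -/
inductive BddFormula : Type
  | eq (s t : L2Term) : BddFormula
  | lt (s t : L2Term) : BddFormula
  | mem (t : L2Term) (X : ℕ) : BddFormula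
  | not (φ : BddFormula) : BddFormula
  | and (φ ψ : BddFormula) : BddFormula
  | or (φ ψ : BddFormula) : BddFormula
  | bdAll (t : L2Term) (φ : BddFormula) : BddFormula
  | bdEx (t : L2Term) (φ : BddFormula) : BddFormula

namespace L2Structure

instance (M : L2Structure.{u}) : Zero M.Num := ⟨M.zero⟩
instance (M : L2Structure.{u}) : One M.Num := ⟨M.one⟩
instance (M : L2Structure.{u}) : Add M.Num := ⟨M.add⟩
instance (M : L2Structure.{u}) : Mul M.Num := ⟨M.mul⟩
instance (M : L2Structure.{u}) : LT M.Num := ⟨M.lt⟩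

variable (M : L2Structure.{u})

/-! ### Satisfaction -/

/-- The assignment giving variable `0` the value `a` and variable `i + 1` the value `e i`. -/
def cons (a : M.Num) (e : ℕ → M.Num) : ℕ → M.Num
  | 0 => a
  | i + 1 => e i

/-- The value of a term under an assignment of the number variables. -/
def termVal (e : ℕ → M.Num) : L2Term → M.Num
  | .var i => e i
  | .zero => 0
  | .one => 1
  | .add s t => termVal e s + termVal e t
  | .mul s t => termVal e s * termVal e t

/-- Satisfaction of a bounded formula, under an assignment `X` of the set variables and an
assignment `e` of the number variables. -/
def Sat (X : ℕ → Set M.Num) : (ℕ → M.Num) → BddFormula → Prop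
  | e, .eq s t => M.termVal e s = M.termVal e t
  | e, .lt s t => M.termVal e s < M.termVal e t
  | e, .mem t i => M.termVal e t ∈ X i
  | e, .not φ => ¬ Sat X e φ
  | e, .and φ ψ => Sat X e φ ∧ Sat X e ψ
  | e, .or φ ψ => Sat X e φ ∨ Sat X e ψ
  | e, .bdAll t φ => ∀ a : M.Num, a < M.termVal e t → Sat X (M.cons a e) φ
  | e, .bdEx t φ => ∃ a : M.Num, a < M.termVal e t ∧ Sat X (M.cons a e) φ

/-- Satisfaction of the `Σ⁰₁` formula `∃ x, φ`, with `φ` bounded. -/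
def SatSigma (X : ℕ → Set M.Num) (e : ℕ → M.Num) (φ : BddFormula) : Prop :=
  ∃ a : M.Num, M.Sat X (M.cons a e) φ

/-- Satisfaction of the `Π⁰₁` formula `∀ x, φ`, with `φ` bounded. -/
def SatPi (X : ℕ → Set M.Num) (e : ℕ → M.Num) (φ : BddFormula) : Prop :=
  ∀ a : M.Num, M.Sat X (M.cons a e) φ

/-! ### The system `RCA₀` -/

/-- The basic axioms of second order arithmetic. -/
structure BasicAxioms : Prop where
  succ_ne_zero : ∀ n : M.Num, n + 1 ≠ 0
  succ_inj : ∀ m n : M.Num, m + 1 = n + 1 → m = n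
  add_zero : ∀ m : M.Num, m + 0 = m
  add_succ : ∀ m n : M.Num, m + (n + 1) = (m + n) + 1
  mul_zero : ∀ m : M.Num, m * 0 = 0
  mul_succ : ∀ m n : M.Num, m * (n + 1) = m * n + m
  not_lt_zero : ∀ m : M.Num, ¬ m < 0
  lt_succ : ∀ m n : M.Num, m < n + 1 ↔ m < n ∨ m = n

/-- The `Σ⁰₁` induction scheme, with number and set parameters. -/
def SigmaInduction : Prop :=
  ∀ (φ : BddFormula) (X : ℕ → Set M.Num) (e : ℕ → M.Num), (∀ i, X i ∈ M.sets) →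
    M.SatSigma X (M.cons 0 e) φ →
    (∀ n, M.SatSigma X (M.cons n e) φ → M.SatSigma X (M.cons (n + 1) e) φ) →
    ∀ n, M.SatSigma X (M.cons n e) φ

/-- The `Δ⁰₁` comprehension scheme, with number and set parameters. -/
def DeltaComprehension : Prop :=
  ∀ (φ ψ : BddFormula) (X : ℕ → Set M.Num) (e : ℕ → M.Num), (∀ i, X i ∈ M.sets) →
    (∀ n, M.SatSigma X (M.cons n e) φ ↔ M.SatPi X (M.cons n e) ψ) →
    ∃ Y ∈ M.sets, ∀ n, n ∈ Y ↔ M.SatSigma X (M.cons n e) φ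

/-- `M` is a model of `RCA₀`. -/
structure RCA0 : Prop where
  basic : M.BasicAxioms
  induction : M.SigmaInduction
  comprehension : M.DeltaComprehension

/-! ### Coding of pairs, finite sets, and finite binary sequences by numbers -/

/-- The code `(i + j)² + i` of the ordered pair `(i, j)`. -/
def pair (i j : M.Num) : M.Num := (i + j) * (i + j) + i

/-- `X` is infinite, that is, unbounded in the numbers of `M`. -/
def IsInfinite (X : Set M.Num) : Prop := ∀ n : M.Num, ∃ m ∈ X, n < m

/-- The finite set represented by `c`: if `c = (k, (m, n))` it consists of the `i < k` such that
`m (i + 1) + 1` divides `n`. -/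
def finSet (c : M.Num) : Set M.Num :=
  {i | ∃ k m n : M.Num, c = M.pair k (M.pair m n) ∧ i < k ∧ ∃ q : M.Num, n = q * (m * (i + 1) + 1)}

/-- `c` has the form `(k, (m, n))`. -/
def IsTriple (c : M.Num) : Prop := ∃ k m n : M.Num, c = M.pair k (M.pair m n)

/-- `c` is the code of a finite set: the least triple representing that set. -/
def IsFinSetCode (c : M.Num) : Prop :=
  M.IsTriple c ∧ ∀ d : M.Num, d < c → M.IsTriple d → M.finSet d ≠ M.finSet c

/-- `s` is the code of a binary sequence of length `l`; the sequence is identified with its graph,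
the finite set of all pairs `(i, s(i))`, `i < l`. -/
structure IsBinSeq (s l : M.Num) : Prop where
  code : M.IsFinSetCode s
  mem : ∀ x ∈ M.finSet s, ∃ i b : M.Num, x = M.pair i b ∧ i < l ∧ (b = 0 ∨ b = 1)
  value : ∀ i : M.Num, i < l → ∃! b : M.Num, M.pair i b ∈ M.finSet s

/-! ### Binary trees and weak König's lemma -/

/-- `T` is (a set of `M` which is) a tree of finite binary sequences, that is, a set of finite
binary sequences closed under initial segments (`s` is an initial segment of `t` when the graph
of `s` is contained in that of `t`). -/
structure IsBinTree (T : Set M.Num) : Prop where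
  isSet : T ∈ M.sets
  seq : ∀ s ∈ T, ∃ l, M.IsBinSeq s l
  closed : ∀ s t l : M.Num, t ∈ T → M.IsBinSeq s l → M.finSet s ⊆ M.finSet t → s ∈ T

/-- `F` is (a set of `M` which is the graph of) a function from the numbers to `{0, 1}`. -/
structure IsBinFunction (F : Set M.Num) : Prop where
  isSet : F ∈ M.sets
  mem : ∀ x ∈ F, ∃ i b : M.Num, x = M.pair i b ∧ (b = 0 ∨ b = 1)
  value : ∀ i : M.Num, ∃! b : M.Num, M.pair i b ∈ F

/-- `F` is a path in `T`: it is a function and for each `n` the sequence `⟨F(0), …, F(n-1)⟩`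
belongs to `T`. -/
def IsPath (T F : Set M.Num) : Prop :=
  M.IsBinFunction F ∧ ∀ n : M.Num, ∃ s ∈ T, M.IsBinSeq s n ∧
    ∀ i b : M.Num, i < n → (M.pair i b ∈ M.finSet s ↔ M.pair i b ∈ F)

/-- Weak König's lemma: every infinite tree of finite binary sequences has a path. -/
def WeakKonig : Prop :=
  ∀ T : Set M.Num, M.IsBinTree T → M.IsInfinite T → ∃ F : Set M.Num, M.IsPath T F

/-- `M` is a model of `WKL₀`. -/
def WKL0 : Prop := M.RCA0 ∧ M.WeakKonig

/-! ### Partial orders -/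

/-- `(P, R)` is a partial order of `M`: `P` and `R` are sets of `M`, `R ⊆ P × P`, and the relation
`x ⪯ y`, meaning that the pair `(x, y)` is in `R`, is reflexive on `P`, antisymmetric and
transitive. -/
structure IsPartialOrder (P R : Set M.Num) : Prop where
  isSet_dom : P ∈ M.sets
  isSet_rel : R ∈ M.sets
  subset : ∀ z ∈ R, ∃ x ∈ P, ∃ y ∈ P, z = M.pair x y
  refl : ∀ x ∈ P, M.pair x x ∈ R
  antisymm : ∀ x ∈ P, ∀ y ∈ P, M.pair x y ∈ R → M.pair y x ∈ R → x = y
  trans : ∀ x ∈ P, ∀ y ∈ P, ∀ z ∈ P, M.pair x y ∈ R → M.pair y z ∈ R → M.pair x z ∈ R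

/-- The strict order `x ≺ y` associated with `R`. -/
def StrictlyBelow (R : Set M.Num) (x y : M.Num) : Prop := M.pair x y ∈ R ∧ x ≠ y

/-- `D` is (a set of `M` which is) an antichain of the partial order `(P, R)`. -/
structure IsAntichain (P R D : Set M.Num) : Prop where
  isSet : D ∈ M.sets
  subset : D ⊆ P
  incomparable : ∀ x ∈ D, ∀ y ∈ D, x ≠ y → M.pair x y ∉ R ∧ M.pair y x ∉ R

/-- `I` is (a set of `M` which is) an initial interval of the partial order `(P, R)`. -/
structure IsInitialInterval (P R I : Set M.Num) : Prop where
  isSet : I ∈ M.sets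
  subset : I ⊆ P
  closed : ∀ x ∈ P, ∀ y ∈ P, M.pair x y ∈ R → y ∈ I → x ∈ I

end L2Structure

/-! From 1 to 2, consider the binary sequences which on `[0, l)` look like the characteristic
function of an initial interval containing `D` with no element strictly above `D`. They form a tree.
It is infinite, because the downward closure of `D ∩ [0, l)` gives such a sequence of length `l`:
something below one element of an antichain cannot be strictly above an element of it. A path is the
desired interval. The downward closure of all of `D` is only `Σ⁰₁`, so it need not be a set of `M`.
From 2 to 3, `I ∩ D = D`.

From 3 to 1, statement 3 yields separation of disjoint `Σ⁰₁` classes `A` and `B`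
(`exists_separating_set`). In `separationOrder` the even number `2m` stands for `m` and the odd
numbers are the antichain. If `m ∈ A`, then `2m` is below all sufficiently large odd numbers, hence
below one in `I`, so `2m ∈ I`. If `m ∈ B`, then `2m` is strictly above an odd number, so `2m ∉ I`.
Thus `{m | 2m ∈ I}` separates `A` from `B`.

Separation gives weak König's lemma: in an infinite tree, separate the sequences whose extensions by
`0` die out first from those whose extensions by `1` die out first. The separating set chooses the
next bit, and by `Π⁰₁` induction the chosen sequences keep extensions of every length
(`Follows.exists_extension`).

As `M` may be nonstandard, each induction, comprehension and search needs a formula of the right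
complexity. Definability is carried by the classes `TermDef`, `BddDef` and `SigmaDef` and found by
instance search. Finite sets are coded by a divisibility form of Gödel's `β` function, and bounds on
codes turn quantifiers over sequences of a given length into bounded ones. -/

namespace L2Term

/-- Renaming of the number variables of a term. -/
def rename (ρ : ℕ → ℕ) : L2Term → L2Term
  | .var i => .var (ρ i)
  | .zero => .zero
  | .one => .one
  | .add s t => .add (s.rename ρ) (t.rename ρ)
  | .mul s t => .mul (s.rename ρ) (t.rename ρ)

end L2Term

namespace BddFormula

/-- The renaming `ρ`, pushed under one binder. -/
def liftRenaming (ρ : ℕ → ℕ) : ℕ → ℕ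
  | 0 => 0
  | i + 1 => ρ i + 1

/-- Renaming of the number variables and of the set variables of a bounded formula. -/
def rename : (ℕ → ℕ) → (ℕ → ℕ) → BddFormula → BddFormula
  | ρ, _, .eq s t => .eq (s.rename ρ) (t.rename ρ)
  | ρ, _, .lt s t => .lt (s.rename ρ) (t.rename ρ)
  | ρ, τ, .mem t X => .mem (t.rename ρ) (τ X)
  | ρ, τ, .not φ => .not (φ.rename ρ τ)
  | ρ, τ, .and φ ψ => .and (φ.rename ρ τ) (ψ.rename ρ τ)
  | ρ, τ, .or φ ψ => .or (φ.rename ρ τ) (ψ.rename ρ τ)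
  | ρ, τ, .bdAll t φ => .bdAll (t.rename ρ) (φ.rename (liftRenaming ρ) τ)
  | ρ, τ, .bdEx t φ => .bdEx (t.rename ρ) (φ.rename (liftRenaming ρ) τ)

end BddFormula

namespace L2Structure

variable {M : L2Structure.{u}}

/-- Assignments of the number variables. -/
abbrev Env (M : L2Structure.{u}) := ℕ → M.Num

theorem termVal_rename (e : M.Env) (ρ : ℕ → ℕ) (t : L2Term) :
    M.termVal e (t.rename ρ) = M.termVal (e ∘ ρ) t := by
  induction t with
  | var i => rfl
  | zero => rfl
  | one => rfl
  | add s t hs ht => simp [L2Term.rename, termVal, hs, ht]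
  | mul s t hs ht => simp [L2Term.rename, termVal, hs, ht]

theorem cons_comp_liftRenaming (a : M.Num) (e : M.Env) (ρ : ℕ → ℕ) :
    M.cons a e ∘ BddFormula.liftRenaming ρ = M.cons a (e ∘ ρ) := by
  funext i
  cases i <;> rfl

theorem sat_rename (X : ℕ → Set M.Num) (τ : ℕ → ℕ) (φ : BddFormula) :
    ∀ (e : M.Env) (ρ : ℕ → ℕ), M.Sat X e (φ.rename ρ τ) ↔ M.Sat (X ∘ τ) (e ∘ ρ) φ := by
  induction φ with
  | eq s t => simp [BddFormula.rename, Sat, termVal_rename]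
  | lt s t => simp [BddFormula.rename, Sat, termVal_rename]
  | mem t X => simp [BddFormula.rename, Sat, termVal_rename]
  | not φ h => simp [BddFormula.rename, Sat, h]
  | and φ ψ h k => simp [BddFormula.rename, Sat, h, k]
  | or φ ψ h k => simp [BddFormula.rename, Sat, h, k]
  | bdAll t φ h => simp [BddFormula.rename, Sat, h, termVal_rename, cons_comp_liftRenaming]
  | bdEx t φ h => simp [BddFormula.rename, Sat, h, termVal_rename, cons_comp_liftRenaming]

/-! ### Definability by terms and bounded formulas with parameters. -/

/-- The assignment which gives variable `i` either the value under `e` of some variable or a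
constant value, as prescribed by `v i`. -/
def look (v : ℕ → ℕ ⊕ M.Num) (e : M.Env) : M.Env := fun i => Sum.elim e id (v i)

/-- The sequence with `v` on the even and `w` on the odd positions. -/
def interleave {α : Type*} (v w : ℕ → α) (i : ℕ) : α := if i % 2 = 0 then v (i / 2) else w (i / 2)

theorem interleave_comp_even {α : Type*} (v w : ℕ → α) :
    interleave v w ∘ (fun i => 2 * i) = v := by
  funext i
  simp [interleave]

theorem interleave_comp_odd {α : Type*} (v w : ℕ → α) :
    interleave v w ∘ (fun i => 2 * i + 1) = w := by
  funext i
  have h : (2 * i + 1) % 2 = 1 := by omega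
  have h' : (2 * i + 1) / 2 = i := by omega
  simp [interleave, h, h']

theorem look_comp (v : ℕ → ℕ ⊕ M.Num) (e : M.Env) (ρ : ℕ → ℕ) :
    look v e ∘ ρ = look (v ∘ ρ) e := rfl

theorem interleave_mem {X Y : ℕ → Set M.Num} (hX : ∀ i, X i ∈ M.sets) (hY : ∀ i, Y i ∈ M.sets)
    (i : ℕ) : interleave X Y i ∈ M.sets := by
  unfold interleave
  split_ifs
  · exact hX _
  · exact hY _

/-- The function `f` of assignments is the value of a term with parameters. -/
class TermDef (f : M.Env → M.Num) : Prop where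
  out : ∃ (t : L2Term) (v : ℕ → ℕ ⊕ M.Num), ∀ e, M.termVal (look v e) t = f e

/-- The relation `p` is definable by a bounded formula with number and set parameters. -/
class BddDef (p : M.Env → Prop) : Prop where
  out : ∃ (φ : BddFormula) (X : ℕ → Set M.Num) (v : ℕ → ℕ ⊕ M.Num),
    (∀ i, X i ∈ M.sets) ∧ ∀ e, M.Sat X (look v e) φ ↔ p e

instance TermDef.var (i : ℕ) : TermDef (fun e : M.Env => e i) :=
  ⟨.var 0, fun _ => .inl i, fun _ => rfl⟩

instance TermDef.const (c : M.Num) : TermDef (fun _ : M.Env => c) :=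
  ⟨.var 0, fun _ => .inr c, fun _ => rfl⟩

instance TermDef.comp (f : M.Env → M.Num) (ρ : ℕ → ℕ) [h : TermDef f] :
    TermDef (fun e : M.Env => f (fun i => e (ρ i))) := by
  obtain ⟨t, v, h⟩ := h
  refine ⟨t, fun i => (v i).map ρ id, fun e => ?_⟩
  rw [← h]
  congr 1
  funext i
  simp only [look]
  cases v i <;> rfl

instance TermDef.add (f g : M.Env → M.Num) [hf : TermDef f] [hg : TermDef g] :
    TermDef (fun e : M.Env => f e + g e) := by
  obtain ⟨t, v, h⟩ := hf
  obtain ⟨s, w, k⟩ := hg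
  refine ⟨.add (t.rename fun i => 2 * i) (s.rename fun i => 2 * i + 1), interleave v w,
    fun e => ?_⟩
  simp only [termVal, termVal_rename, look_comp, interleave_comp_even, interleave_comp_odd, h, k]

instance TermDef.mul (f g : M.Env → M.Num) [hf : TermDef f] [hg : TermDef g] :
    TermDef (fun e : M.Env => f e * g e) := by
  obtain ⟨t, v, h⟩ := hf
  obtain ⟨s, w, k⟩ := hg
  refine ⟨.mul (t.rename fun i => 2 * i) (s.rename fun i => 2 * i + 1), interleave v w,
    fun e => ?_⟩
  simp only [termVal, termVal_rename, look_comp, interleave_comp_even, interleave_comp_odd, h, k]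

theorem BddDef.congr {p q : M.Env → Prop} (h : BddDef q) (hpq : ∀ e, p e ↔ q e) : BddDef p := by
  obtain ⟨φ, X, v, hX, h⟩ := h
  exact ⟨φ, X, v, hX, fun e => (h e).trans (hpq e).symm⟩

theorem exists_seq_sets (M : L2Structure.{u}) : ∃ X : ℕ → Set M.Num, ∀ i, X i ∈ M.sets :=
  ⟨fun _ => M.sets_nonempty.some, fun _ => M.sets_nonempty.some_mem⟩

instance BddDef.eq (f g : M.Env → M.Num) [hf : TermDef f] [hg : TermDef g] :
    BddDef (fun e : M.Env => f e = g e) := by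
  obtain ⟨t, v, h⟩ := hf
  obtain ⟨s, w, k⟩ := hg
  obtain ⟨X, hX⟩ := exists_seq_sets M
  refine ⟨.eq (t.rename fun i => 2 * i) (s.rename fun i => 2 * i + 1), X, interleave v w, hX,
    fun e => ?_⟩
  simp only [Sat, termVal_rename, look_comp, interleave_comp_even, interleave_comp_odd, h, k]

instance BddDef.lt (f g : M.Env → M.Num) [hf : TermDef f] [hg : TermDef g] :
    BddDef (fun e : M.Env => f e < g e) := by
  obtain ⟨t, v, h⟩ := hf
  obtain ⟨s, w, k⟩ := hg
  obtain ⟨X, hX⟩ := exists_seq_sets M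
  refine ⟨.lt (t.rename fun i => 2 * i) (s.rename fun i => 2 * i + 1), X, interleave v w, hX,
    fun e => ?_⟩
  simp only [Sat, termVal_rename, look_comp, interleave_comp_even, interleave_comp_odd, h, k]

instance BddDef.mem (f : M.Env → M.Num) (S : Set M.Num) [hf : TermDef f]
    [hS : Fact (S ∈ M.sets)] : BddDef (fun e : M.Env => f e ∈ S) := by
  obtain ⟨t, v, h⟩ := hf
  refine ⟨.mem t 0, fun _ => S, v, fun _ => hS.out, fun e => ?_⟩
  simp only [Sat, h]

instance BddDef.not (p : M.Env → Prop) [hp : BddDef p] : BddDef (fun e : M.Env => ¬ p e) := by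
  obtain ⟨φ, X, v, hX, h⟩ := hp
  refine ⟨.not φ, X, v, hX, fun e => ?_⟩
  simp only [Sat, h]

instance BddDef.and (p q : M.Env → Prop) [hp : BddDef p] [hq : BddDef q] :
    BddDef (fun e : M.Env => p e ∧ q e) := by
  obtain ⟨φ, X, v, hX, h⟩ := hp
  obtain ⟨ψ, Y, w, hY, k⟩ := hq
  refine ⟨.and (φ.rename (fun i => 2 * i) (fun i => 2 * i))
    (ψ.rename (fun i => 2 * i + 1) (fun i => 2 * i + 1)), interleave X Y, interleave v w,
    interleave_mem hX hY, fun e => ?_⟩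
  simp only [Sat, sat_rename, look_comp, interleave_comp_even, interleave_comp_odd, h, k]

instance BddDef.or (p q : M.Env → Prop) [hp : BddDef p] [hq : BddDef q] :
    BddDef (fun e : M.Env => p e ∨ q e) :=
  (inferInstance : BddDef (fun e : M.Env => ¬ (¬ p e ∧ ¬ q e))).congr fun e => by tauto

instance BddDef.imp (p q : M.Env → Prop) [hp : BddDef p] [hq : BddDef q] :
    BddDef (fun e : M.Env => p e → q e) :=
  (inferInstance : BddDef (fun e : M.Env => ¬ p e ∨ q e)).congr fun e => by tauto

instance BddDef.iff (p q : M.Env → Prop) [hp : BddDef p] [hq : BddDef q] :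
    BddDef (fun e : M.Env => p e ↔ q e) :=
  (inferInstance : BddDef (fun e : M.Env => (p e → q e) ∧ (q e → p e))).congr fun e => by tauto

theorem BddDef.comp_look {p : M.Env → Prop} (h : BddDef p) (ρ : ℕ → ℕ ⊕ M.Num) :
    BddDef (fun e : M.Env => p (look ρ e)) := by
  obtain ⟨φ, X, v, hX, h⟩ := h
  refine ⟨φ, X, fun i => Sum.elim ρ .inr (v i), hX, fun e => ?_⟩
  rw [← h]
  have : look (fun i => Sum.elim ρ .inr (v i)) e
      = look v (look ρ e) := by
    funext i
    simp only [look]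
    cases v i <;> rfl
  rw [this]

instance BddDef.comp (p : M.Env → Prop) (ρ : ℕ → ℕ) [h : BddDef p] :
    BddDef (fun e : M.Env => p (fun i => e (ρ i))) :=
  h.comp_look fun i => .inl (ρ i)

theorem BddDef.comp_cons {p : M.Env → Prop} (h : BddDef p) (i : ℕ) (ρ : ℕ → ℕ) :
    BddDef (fun e : M.Env => p (M.cons (e i) fun j => e (ρ j))) :=
  (BddDef.comp p (fun j => match j with | 0 => i | j + 1 => ρ j)).congr fun e => by
    refine iff_of_eq (congrArg p ?_)
    funext j
    cases j <;> rfl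

instance BddDef.bdAll (f : M.Env → M.Num) (p : M.Num → M.Env → Prop) [hf : TermDef f]
    [hp : BddDef (fun e : M.Env => p (e 0) (fun i => e (i + 1)))] :
    BddDef (fun e : M.Env => ∀ a, a < f e → p a e) := by
  obtain ⟨t, v, h⟩ := hf
  obtain ⟨φ, X, w, hX, k⟩ := hp
  classical
  let w' : ℕ → ℕ ⊕ M.Num := fun i => (w i).map (fun j => j - 1) id
  -- Variables of `φ` which stand for the bound variable go to `0`. The others go to the odd
  -- positions of the merged assignment, and the last `+ 1` steps over the binder.
  let ρ : ℕ → ℕ := fun i => if w i = .inl 0 then 0 else 2 * i + 1 + 1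
  have key : ∀ a e, M.cons a (look (interleave v w') e) ∘ ρ = look w (M.cons a e) := by
    intro a e
    funext i
    have h1 : interleave v w' (2 * i + 1) = w' i := congrFun (interleave_comp_odd v w') i
    by_cases hi : w i = .inl 0
    · simp [ρ, hi, look, cons]
    · simp only [Function.comp, ρ, hi, if_false, cons, look, h1, w']
      rcases hw : w i with (_ | j) | c
      · exact absurd hw hi
      · rfl
      · rfl
  refine ⟨.bdAll (t.rename fun i => 2 * i) (φ.rename ρ id), X, interleave v w', hX, fun e => ?_⟩
  simp only [Sat, sat_rename, termVal_rename, look_comp, interleave_comp_even, h]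
  simp only [key, Function.comp_id, k]
  rfl

instance BddDef.bdEx (f : M.Env → M.Num) (p : M.Num → M.Env → Prop) [hf : TermDef f]
    [hp : BddDef (fun e : M.Env => p (e 0) (fun i => e (i + 1)))] :
    BddDef (fun e : M.Env => ∃ a, a < f e ∧ p a e) :=
  (BddDef.not _ (hp := BddDef.bdAll f (fun a e => ¬ p a e))).congr fun e => by
    push Not
    rfl

instance BddDef.comp_const (q : Prop) : BddDef (fun _ : M.Env => q) := by
  by_cases hq : q
  · exact (BddDef.eq (fun _ : M.Env => (0 : M.Num)) (fun _ => 0)).congr fun e => by simp [hq]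
  · exact (BddDef.not _ (hp := BddDef.eq (fun _ : M.Env => (0 : M.Num)) (fun _ => 0))).congr
      fun e => by simp [hq]

/-- The axiom schemes evaluate their formulas under one common assignment, with the matrix variables
at indices `0` and `1`. Parameters of both relations are therefore merged into one list placed
behind these two variables. -/
theorem exists_bddFormula₂ (p q : M.Num → M.Num → Prop)
    (hp : BddDef (fun e : M.Env => p (e 1) (e 0))) (hq : BddDef (fun e : M.Env => q (e 1) (e 0))) :
    ∃ (φ ψ : BddFormula) (X : ℕ → Set M.Num) (e : M.Env), (∀ i, X i ∈ M.sets) ∧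
      (∀ n a, M.Sat X (M.cons a (M.cons n e)) φ ↔ p n a) ∧
      ∀ n a, M.Sat X (M.cons a (M.cons n e)) ψ ↔ q n a := by
  obtain ⟨φ, X, v, hX, h⟩ := hp
  obtain ⟨ψ, Y, w, hY, k⟩ := hq
  let ρ (v : ℕ → ℕ ⊕ M.Num) (σ : ℕ → ℕ) (i : ℕ) : ℕ := match v i with
    | .inl 0 => 0
    | .inl 1 => 1
    | _ => σ i + 2
  -- The value `0` for proper variables is a default: indices `0` and `1` are not routed here, and
  -- `p` and `q` do not look at the higher ones.
  let d (v : ℕ → ℕ ⊕ M.Num) (i : ℕ) : M.Num := Sum.elim (fun _ => 0) id (v i)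
  have key (v : ℕ → ℕ ⊕ M.Num) (e : M.Env) (σ : ℕ → ℕ) (he : e ∘ σ = d v) (n a : M.Num) :
      M.cons a (M.cons n e) ∘ ρ v σ = look v (M.cons a (M.cons n fun _ => 0)) := by
    funext i
    have hi : e (σ i) = d v i := congrFun he i
    simp only [Function.comp, look, ρ]
    rcases hv : v i with (_ | _ | j) | c <;> simp [cons, hv, hi, d]
  refine ⟨φ.rename (ρ v fun i => 2 * i) (fun i => 2 * i),
    ψ.rename (ρ w fun i => 2 * i + 1) (fun i => 2 * i + 1), interleave X Y,
    interleave (d v) (d w), interleave_mem hX hY, fun n a => ?_, fun n a => ?_⟩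
  · rw [sat_rename, interleave_comp_even, key _ _ _ (interleave_comp_even _ _), h]
    rfl
  · rw [sat_rename, interleave_comp_odd, key _ _ _ (interleave_comp_odd _ _), k]
    rfl

/-! ### `Σ⁰₁` definability, and the axiom schemes for definable predicates. -/

/-- `p` is definable by a `Σ⁰₁` formula with parameters. -/
class SigmaDef (p : M.Env → Prop) : Prop where
  out : ∃ q : M.Num → M.Env → Prop, BddDef (fun e : M.Env => q (e 0) (fun i => e (i + 1))) ∧
    ∀ e, p e ↔ ∃ a, q a e

theorem SigmaDef.congr {p q : M.Env → Prop} (h : SigmaDef q) (hpq : ∀ e, p e ↔ q e) :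
    SigmaDef p := by
  obtain ⟨r, hr, h⟩ := h
  exact ⟨r, hr, fun e => (hpq e).trans (h e)⟩

instance (priority := 100) SigmaDef.ofBddDef (p : M.Env → Prop) [h : BddDef p] : SigmaDef p :=
  ⟨fun _ e => p e, inferInstance, fun _ => ⟨fun h => ⟨0, h⟩, fun ⟨_, h⟩ => h⟩⟩

theorem SigmaDef.exists_binary {p : M.Num → Prop} (hp : SigmaDef (fun e : M.Env => p (e 0))) :
    ∃ q : M.Num → M.Num → Prop, BddDef (fun e : M.Env => q (e 1) (e 0)) ∧
      ∀ n, p n ↔ ∃ a, q n a := by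
  obtain ⟨q, hq, h⟩ := hp
  refine ⟨fun n a => q a (fun _ => n), ?_, fun n => h fun _ => n⟩
  exact BddDef.comp _ (fun i => match i with | 0 => 0 | _ + 1 => 1) (h := hq)

theorem SigmaInduction.induct (hM : M.SigmaInduction) (p : M.Num → Prop)
    (hp : SigmaDef (fun e : M.Env => p (e 0)))
    (zero : p 0) (succ : ∀ n, p n → p (n + 1)) (n : M.Num) : p n := by
  obtain ⟨q, hq, h⟩ := hp.exists_binary
  obtain ⟨φ, -, X, e, hX, hφ, -⟩ := exists_bddFormula₂ q q hq hq
  have key (n : M.Num) : M.SatSigma X (M.cons n e) φ ↔ p n := by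
    simp only [SatSigma, hφ, h]
  have := hM φ X e hX
  simp only [key] at this
  exact this zero succ n

theorem DeltaComprehension.exists_set (hM : M.DeltaComprehension) (p : M.Num → Prop)
    (hp : SigmaDef (fun e : M.Env => p (e 0))) (hp' : SigmaDef (fun e : M.Env => ¬ p (e 0))) :
    ∃ Y ∈ M.sets, ∀ n, n ∈ Y ↔ p n := by
  obtain ⟨q, hq, h⟩ := hp.exists_binary
  obtain ⟨r, hr, k⟩ := SigmaDef.exists_binary (p := fun n => ¬ p n) hp'
  obtain ⟨φ, ψ, X, e, hX, hφ, hψ⟩ :=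
    exists_bddFormula₂ q (fun n a => ¬ r n a) hq (BddDef.not _ (hp := hr))
  have key (n : M.Num) : M.SatSigma X (M.cons n e) φ ↔ p n := by
    simp only [SatSigma, hφ, h]
  have key' (n : M.Num) : M.SatPi X (M.cons n e) ψ ↔ p n := by
    simp only [SatPi, hψ, ← not_exists, ← k, not_not]
  have := hM φ ψ X e hX
  simp only [key, key', implies_true, forall_const] at this
  exact this

variable [hM : Fact M.RCA0]

theorem induct (p : M.Num → Prop) [hp : SigmaDef (fun e : M.Env => p (e 0))]
    (zero : p 0) (succ : ∀ n, p n → p (n + 1)) (n : M.Num) : p n :=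
  hM.out.induction.induct p hp zero succ n

/-! ### The semiring of numbers. -/

namespace Arith

theorem basic : M.BasicAxioms := hM.out.basic

theorem zero_add (n : M.Num) : 0 + n = n := by
  refine induct (fun n : M.Num => 0 + n = n) ?_ (fun n ih => ?_) n
  · exact basic.add_zero 0
  · rw [basic.add_succ, ih]

theorem succ_add (m n : M.Num) : (m + 1) + n = (m + n) + 1 := by
  refine induct (fun n : M.Num => (m + 1) + n = (m + n) + 1) ?_ (fun n ih => ?_) n
  · rw [basic.add_zero, basic.add_zero]
  · rw [basic.add_succ, basic.add_succ, ih]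

theorem add_comm (m n : M.Num) : m + n = n + m := by
  refine induct (fun n : M.Num => m + n = n + m) ?_ (fun n ih => ?_) n
  · rw [basic.add_zero, zero_add]
  · rw [basic.add_succ, succ_add, ih]

theorem add_assoc (k m n : M.Num) : k + m + n = k + (m + n) := by
  refine induct (fun n : M.Num => k + m + n = k + (m + n)) ?_ (fun n ih => ?_) n
  · rw [basic.add_zero, basic.add_zero]
  · rw [basic.add_succ, basic.add_succ, basic.add_succ, ih]

theorem left_distrib (k m n : M.Num) : k * (m + n) = k * m + k * n := by
  refine induct (fun n : M.Num => k * (m + n) = k * m + k * n) ?_ (fun n ih => ?_) n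
  · rw [basic.add_zero, basic.mul_zero, basic.add_zero]
  · rw [basic.add_succ, basic.mul_succ, basic.mul_succ, ih, add_assoc]

theorem mul_assoc (k m n : M.Num) : k * m * n = k * (m * n) := by
  refine induct (fun n : M.Num => k * m * n = k * (m * n)) ?_ (fun n ih => ?_) n
  · rw [basic.mul_zero, basic.mul_zero, basic.mul_zero]
  · rw [basic.mul_succ, basic.mul_succ, left_distrib, ih]

theorem zero_mul (n : M.Num) : 0 * n = 0 := by
  refine induct (fun n : M.Num => 0 * n = 0) ?_ (fun n ih => ?_) n
  · exact basic.mul_zero 0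
  · rw [basic.mul_succ, ih, basic.add_zero]

theorem mul_one (n : M.Num) : n * 1 = n := by
  have h := basic.mul_succ n 0
  rwa [zero_add, basic.mul_zero, zero_add] at h

theorem succ_mul (m n : M.Num) : (m + 1) * n = m * n + n := by
  refine induct (fun n : M.Num => (m + 1) * n = m * n + n) ?_ (fun n ih => ?_) n
  · rw [basic.mul_zero, basic.mul_zero, basic.add_zero]
  · rw [basic.mul_succ, basic.mul_succ, ih, add_assoc, add_assoc, ← add_assoc n m, add_comm n m,
      add_assoc, ← add_assoc]

theorem mul_comm (m n : M.Num) : m * n = n * m := by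
  refine induct (fun n : M.Num => m * n = n * m) ?_ (fun n ih => ?_) n
  · rw [basic.mul_zero, zero_mul]
  · rw [basic.mul_succ, succ_mul, ih]

end Arith

/-- The numbers of a model of `RCA₀` form a commutative semiring. -/
noncomputable instance : CommSemiring M.Num where
  -- The operations are definitionally those of `M`, so that values of formal terms are semiring
  -- expressions.
  add := (· + ·)
  zero := 0
  mul := (· * ·)
  one := 1
  add_assoc := Arith.add_assoc
  zero_add := Arith.zero_add
  add_zero := Arith.basic.add_zero
  add_comm := Arith.add_comm
  left_distrib := Arith.left_distrib
  right_distrib a b c := by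
    rw [Arith.mul_comm, Arith.left_distrib, Arith.mul_comm c, Arith.mul_comm c]
  zero_mul := Arith.zero_mul
  mul_zero := Arith.basic.mul_zero
  mul_assoc := Arith.mul_assoc
  one_mul n := by rw [Arith.mul_comm, Arith.mul_one]
  mul_one := Arith.mul_one
  mul_comm := Arith.mul_comm
  nsmul := nsmulRec

namespace Arith

theorem add_right_cancel' (a b c : M.Num) : a + c = b + c → a = b := by
  refine induct (fun c : M.Num => a + c = b + c → a = b) ?_ (fun n ih h => ?_) c
  · simp
  · exact ih (basic.succ_inj _ _ (by simpa only [_root_.add_assoc] using h))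

/-- If `n` were neither zero nor a successor, induction on `k` would show `k ≠ n` for every `k`,
including `n`. -/
theorem eq_zero_or_exists (n : M.Num) : n = 0 ∨ ∃ m, n = m + 1 := by
  by_contra! h
  have : ∀ k : M.Num, k ≠ n := by
    refine induct (fun k : M.Num => k ≠ n) h.1.symm (fun k _ => (h.2 k).symm)
  exact this n rfl

end Arith

instance SigmaDef.ex (p : M.Num → M.Env → Prop)
    [hp : BddDef (fun e : M.Env => p (e 0) (fun i => e (i + 1)))] :
    SigmaDef (fun e : M.Env => ∃ a, p a e) :=
  ⟨p, hp, fun _ => Iff.rfl⟩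

/-! ### The order of the numbers. -/

namespace Arith

theorem lt_iff (m n : M.Num) : m < n ↔ ∃ d, n = m + d + 1 := by
  constructor
  · intro h
    -- The existential quantifier stands in front of the implication to make the induction formula
    -- `Σ⁰₁` with a bounded matrix.
    have : ∃ d, m < n → n = m + d + 1 := by
      refine induct (fun n : M.Num => ∃ d, m < n → n = m + d + 1) ?_ (fun n ih => ?_) n
      · exact ⟨0, fun h => absurd h (basic.not_lt_zero m)⟩
      · obtain ⟨d, hd⟩ := ih
        by_cases hm : m = n
        · exact ⟨0, fun _ => by rw [hm, basic.add_zero]⟩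
        · refine ⟨d + 1, fun h => ?_⟩
          rw [hd (((basic.lt_succ m n).1 h).resolve_right hm)]
          ring
    exact this.imp fun d hd => hd h
  · rintro ⟨d, rfl⟩
    refine induct (fun d : M.Num => m < m + d + 1) ?_ (fun d ih => ?_) d
    · rw [basic.add_zero]
      exact (basic.lt_succ m m).2 (.inr rfl)
    · rw [← basic.add_succ] at ih
      exact (basic.lt_succ _ _).2 (.inl ih)

theorem le_total (m n : M.Num) : (∃ d, n = m + d) ∨ ∃ d, m = n + d := by
  have : ∃ d, n = m + d ∨ m = n + d := by
    refine induct (fun n : M.Num => ∃ d, n = m + d ∨ m = n + d) ?_ (fun n ih => ?_) n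
    · exact ⟨m, .inr (by ring)⟩
    · obtain ⟨d, rfl | rfl⟩ := ih
      · exact ⟨d + 1, .inl (by ring)⟩
      · obtain rfl | ⟨d, rfl⟩ := eq_zero_or_exists d
        · exact ⟨1, .inl (by ring)⟩
        · exact ⟨d, .inr (by ring)⟩
  obtain ⟨d, h | h⟩ := this
  exacts [.inl ⟨d, h⟩, .inr ⟨d, h⟩]

theorem eq_zero_of_add_eq (m d : M.Num) (h : m = m + d) : d = 0 := by
  apply add_right_cancel' d 0 m
  rw [_root_.zero_add, _root_.add_comm, ← h]

theorem eq_zero_of_add_eq_zero (d e : M.Num) (h : d + e = 0) : e = 0 := by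
  obtain h' | ⟨e, rfl⟩ := eq_zero_or_exists e
  · exact h'
  · exact absurd h (by rw [← _root_.add_assoc]; exact basic.succ_ne_zero _)

end Arith

open Classical in
/-- The order of the numbers of a model of `RCA₀`. -/
noncomputable instance : LinearOrder M.Num where
  le m n := ∃ d, n = m + d
  lt := (· < ·)
  le_refl m := ⟨0, (add_zero m).symm⟩
  le_trans := by
    rintro a b c ⟨d, rfl⟩ ⟨e, rfl⟩
    exact ⟨d + e, add_assoc _ _ _⟩
  lt_iff_le_not_ge a b := by
    rw [Arith.lt_iff]
    constructor
    · rintro ⟨d, rfl⟩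
      refine ⟨⟨d + 1, add_assoc _ _ _⟩, ?_⟩
      rintro ⟨e, h⟩
      have := Arith.eq_zero_of_add_eq a (d + e + 1) (h.trans (by ring))
      exact Arith.basic.succ_ne_zero _ this
    · rintro ⟨⟨d, rfl⟩, h⟩
      obtain rfl | ⟨d, rfl⟩ := Arith.eq_zero_or_exists d
      · exact absurd ⟨0, by ring⟩ h
      · exact ⟨d, (add_assoc _ _ _).symm⟩
  le_antisymm := by
    rintro a b ⟨d, rfl⟩ ⟨e, h⟩
    have h1 := Arith.eq_zero_of_add_eq a (e + d) (h.trans (by ring))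
    rw [Arith.eq_zero_of_add_eq_zero _ _ h1, add_zero]
  le_total := Arith.le_total
  toDecidableLE := Classical.decRel _

theorem lt_add_one_iff' (m n : M.Num) : m < n + 1 ↔ m ≤ n := by
  rw [Arith.basic.lt_succ, le_iff_lt_or_eq]

theorem add_one_le_iff' (m n : M.Num) : m + 1 ≤ n ↔ m < n := by
  rw [← not_lt, lt_add_one_iff', not_le]

theorem mul_lt_mul_aux (a b c : M.Num) (ha : 0 < a) (h : b < c) : a * b < a * c := by
  rw [Arith.lt_iff] at *
  obtain ⟨a, rfl⟩ := ha
  obtain ⟨d, rfl⟩ := h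
  exact ⟨a * d + a + d, by ring⟩

instance : IsStrictOrderedRing M.Num where
  add_le_add_left := by
    rintro a b ⟨d, rfl⟩ c
    exact ⟨d, by ring⟩
  le_of_add_le_add_left := by
    rintro a b c ⟨d, h⟩
    refine ⟨d, Arith.add_right_cancel' _ _ a ?_⟩
    rw [add_comm, h]
    ring
  zero_le_one := ⟨1, (zero_add _).symm⟩
  exists_pair_ne := ⟨0 + 1, 0, Arith.basic.succ_ne_zero 0⟩
  mul_lt_mul_of_pos_left a ha b c h := mul_lt_mul_aux a b c ha h
  mul_lt_mul_of_pos_right a ha b c h := by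
    rw [mul_comm b, mul_comm c]
    exact mul_lt_mul_aux a b c ha h

theorem num_nonneg (n : M.Num) : 0 ≤ n := ⟨n, (zero_add n).symm⟩

instance BddDef.le (f g : M.Env → M.Num) [TermDef f] [TermDef g] :
    BddDef (fun e : M.Env => f e ≤ g e) :=
  (inferInstance : BddDef (fun e : M.Env => f e < g e + 1)).congr
    fun _ => (lt_add_one_iff' _ _).symm

instance BddDef.allLE (f : M.Env → M.Num) (p : M.Num → M.Env → Prop) [TermDef f]
    [BddDef (fun e : M.Env => p (e 0) (fun i => e (i + 1)))] :
    BddDef (fun e : M.Env => ∀ a, a ≤ f e → p a e) :=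
  (inferInstance : BddDef (fun e : M.Env => ∀ a, a < f e + 1 → p a e)).congr
    fun _ => by simp only [lt_add_one_iff']

instance BddDef.exLE (f : M.Env → M.Num) (p : M.Num → M.Env → Prop) [TermDef f]
    [BddDef (fun e : M.Env => p (e 0) (fun i => e (i + 1)))] :
    BddDef (fun e : M.Env => ∃ a, a ≤ f e ∧ p a e) :=
  (inferInstance : BddDef (fun e : M.Env => ∃ a, a < f e + 1 ∧ p a e)).congr
    fun _ => by simp only [lt_add_one_iff']

/-! ### Closure properties of `Σ⁰₁` relations, collection, and further forms of induction. -/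

instance SigmaDef.ex' (p : M.Num → M.Env → Prop)
    [hp : SigmaDef (fun e : M.Env => p (e 0) (fun i => e (i + 1)))] :
    SigmaDef (fun e : M.Env => ∃ a, p a e) := by
  obtain ⟨q, hq, h⟩ := hp
  have hq' : BddDef (fun e : M.Env => q (e 0) (M.cons (e 1) fun i => e (i + 3))) :=
    (hq.comp_cons 0 (fun j => match j with | 0 => 1 | j + 1 => j + 3)).congr fun e => by
      refine iff_of_eq (congrArg (q (e 0)) ?_)
      funext j
      cases j <;> rfl
  -- A single `c` bounds both witnesses and so contracts two unbounded quantifiers into one.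
  have : SigmaDef (fun e : M.Env => ∃ c, ∃ a, a < c ∧ ∃ b, b < c ∧ q b (M.cons a e)) :=
    inferInstance
  refine this.congr fun e => ⟨?_, ?_⟩
  · rintro ⟨a, ha⟩
    obtain ⟨b, hb⟩ := (h (M.cons a e)).1 ha
    exact ⟨a + b + 1, a, (lt_add_one_iff' _ _).2 ⟨b, rfl⟩, b,
      (lt_add_one_iff' _ _).2 ⟨a, add_comm _ _⟩, hb⟩
  · rintro ⟨c, a, -, b, -, hb⟩
    exact ⟨a, (h (M.cons a e)).2 ⟨b, hb⟩⟩

instance SigmaDef.or (p q : M.Env → Prop) [hp : SigmaDef p] [hq : SigmaDef q] :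
    SigmaDef (fun e : M.Env => p e ∨ q e) := by
  obtain ⟨p', hp', h⟩ := hp
  obtain ⟨q', hq', k⟩ := hq
  refine ⟨fun a e => p' a e ∨ q' a e, inferInstance, fun e => ?_⟩
  rw [h, k, exists_or]

instance SigmaDef.and (p q : M.Env → Prop) [hp : SigmaDef p] [hq : SigmaDef q] :
    SigmaDef (fun e : M.Env => p e ∧ q e) := by
  obtain ⟨p', hp', h⟩ := hp
  obtain ⟨q', hq', k⟩ := hq
  have hp'' : BddDef (fun e : M.Env => p' (e 1) (fun i => e (i + 2))) :=
    BddDef.comp _ (fun i => i + 1) (h := hp')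
  have hq'' : BddDef (fun e : M.Env => q' (e 0) (fun i => e (i + 2))) :=
    (hq'.comp_cons 0 fun j => j + 2).congr fun e => Iff.rfl
  have : SigmaDef (fun e : M.Env => ∃ a, ∃ b, p' a e ∧ q' b e) := inferInstance
  refine this.congr fun e => ?_
  rw [h, k]
  simp only [exists_and_left, exists_and_right]

/-- `Σ⁰₁` collection for bounded formulas. -/
theorem collection (p : M.Num → M.Num → Prop) [hp : BddDef (fun e : M.Env => p (e 1) (e 0))]
    (n : M.Num) (h : ∀ a, a < n → ∃ b, p a b) : ∃ c, ∀ a, a < n → ∃ b, b < c ∧ p a b := by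
  have hp' : BddDef (fun e : M.Env => p (e 1) (e 0)) := hp
  -- The restriction `m ≤ n` makes `h` available in the induction step; under the quantifier `∃ c`
  -- it keeps the formula `Σ⁰₁`.
  have key : ∀ m : M.Num, ∃ c, m ≤ n → ∀ a, a < m → ∃ b, b < c ∧ p a b := by
    refine induct (fun m : M.Num => ∃ c, m ≤ n → ∀ a, a < m → ∃ b, b < c ∧ p a b) ?_ ?_
    · exact ⟨0, fun _ a ha => absurd ha (Arith.basic.not_lt_zero a)⟩
    · rintro m ⟨c, hc⟩
      by_cases hm : m + 1 ≤ n
      · rw [add_one_le_iff'] at hm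
        obtain ⟨b, hb⟩ := h m hm
        refine ⟨c + b + 1, fun _ a ha => ?_⟩
        rw [lt_add_one_iff', le_iff_lt_or_eq] at ha
        rcases ha with ha | rfl
        · obtain ⟨b', hb', h'⟩ := hc hm.le a ha
          exact ⟨b', hb'.trans ((lt_add_one_iff' _ _).2 ⟨b, rfl⟩), h'⟩
        · exact ⟨b, (lt_add_one_iff' _ _).2 ⟨c, add_comm _ _⟩, hb⟩
      · exact ⟨0, fun h => absurd h hm⟩
  obtain ⟨c, hc⟩ := key n
  exact ⟨c, hc le_rfl⟩

instance SigmaDef.bdAll (f : M.Env → M.Num) (p : M.Num → M.Env → Prop) [hf : TermDef f]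
    [hp : SigmaDef (fun e : M.Env => p (e 0) (fun i => e (i + 1)))] :
    SigmaDef (fun e : M.Env => ∀ a, a < f e → p a e) := by
  obtain ⟨q, hq, h⟩ := hp
  have hq' : BddDef (fun e : M.Env => q (e 0) (M.cons (e 1) fun i => e (i + 3))) :=
    (hq.comp_cons 0 (fun j => match j with | 0 => 1 | j + 1 => j + 3)).congr fun e => by
      refine iff_of_eq (congrArg (q (e 0)) ?_)
      funext j
      cases j <;> rfl
  have : SigmaDef (fun e : M.Env => ∃ c, ∀ a, a < f e → ∃ b, b < c ∧ q b (M.cons a e)) :=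
    inferInstance
  refine this.congr fun e => ⟨fun ha => ?_, ?_⟩
  -- Collection is used for a fixed `e`, whose values become number parameters.
  · have : BddDef (fun e' : M.Env => q (e' 0) (M.cons (e' 1) e)) :=
      (hq.comp_look (fun j => match j with | 0 => .inl 0 | 1 => .inl 1 | j + 2 => .inr (e j))).congr
        fun e' => by
          refine iff_of_eq (congrArg (q (e' 0)) ?_)
          funext j
          cases j <;> rfl
    exact collection (fun a b => q b (M.cons a e)) (f e) fun a h' => (h (M.cons a e)).1 (ha a h')
  · rintro ⟨c, hc⟩ a ha
    obtain ⟨b, -, hb⟩ := hc a ha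
    exact (h (M.cons a e)).2 ⟨b, hb⟩

/-- The least number principle for `Π⁰₁` formulas. -/
theorem exists_least (p : M.Num → Prop) [hp : SigmaDef (fun e : M.Env => ¬ p (e 0))]
    (h : ∃ n, p n) : ∃ n, p n ∧ ∀ m, m < n → ¬ p m := by
  by_contra! hn
  obtain ⟨n, h⟩ := h
  have key : ∀ n : M.Num, ∀ m, m < n → ¬ p m := by
    refine induct (hp := SigmaDef.bdAll (fun e : M.Env => e 0) (fun m _ => ¬ p m))
      (fun n : M.Num => ∀ m, m < n → ¬ p m) ?_ ?_
    · exact fun m hm => absurd hm (Arith.basic.not_lt_zero m)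
    · intro n ih m hm hpm
      rw [lt_add_one_iff', le_iff_lt_or_eq] at hm
      rcases hm with hm | rfl
      · exact ih m hm hpm
      · obtain ⟨k, hk, hpk⟩ := hn m hpm
        exact ih k hk hpk
  exact key (n + 1) n ((lt_add_one_iff' _ _).2 le_rfl) h

/-- Induction for `Π⁰₁` formulas. -/
theorem induct_pi (p : M.Num → Prop) [hp : SigmaDef (fun e : M.Env => ¬ p (e 0))]
    (zero : p 0) (succ : ∀ n, p n → p (n + 1)) (n : M.Num) : p n := by
  by_contra hn
  have hp' : SigmaDef (fun e : M.Env => ¬ p (e 0)) := hp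
  -- A failure at `n` is pushed down to a failure at `n - x`, which is a `Σ⁰₁` induction on `x`. At
  -- `x = n` it reaches `0`.
  have key : ∀ x : M.Num, n < x ∨ ∃ y, n = x + y ∧ ¬ p y := by
    refine induct (fun x : M.Num => n < x ∨ ∃ y, n = x + y ∧ ¬ p y) (.inr ⟨n, by ring, hn⟩) ?_
    rintro x (h | ⟨y, hy, hpy⟩)
    · exact .inl (h.trans ((lt_add_one_iff' _ _).2 le_rfl))
    · obtain rfl | ⟨y, rfl⟩ := Arith.eq_zero_or_exists y
      · exact absurd zero hpy
      · exact .inr ⟨y, by rw [hy]; ring, fun h => hpy (succ y h)⟩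
  obtain h | ⟨y, hy, hpy⟩ := key n
  · exact lt_irrefl _ h
  · have : y = 0 := Arith.eq_zero_of_add_eq n y hy
    exact hpy (this ▸ zero)

/-- Course-of-values induction for `Σ⁰₁` formulas. -/
theorem strong_induct (p : M.Num → Prop) [hp : SigmaDef (fun e : M.Env => p (e 0))]
    (step : ∀ n, (∀ m, m < n → p m) → p n) (n : M.Num) : p n := by
  have hp' : SigmaDef (fun e : M.Env => ¬ ¬ p (e 0)) := hp.congr fun _ => not_not
  by_contra hn
  obtain ⟨m, hm, h⟩ := exists_least (fun n => ¬ p n) ⟨n, hn⟩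
  exact hm (step m fun k hk => not_not.1 (h k hk))

theorem lt_add_one' (n : M.Num) : n < n + 1 := (lt_add_one_iff' n n).2 le_rfl

theorem num_pos_iff (n : M.Num) : 0 < n ↔ n ≠ 0 := (num_nonneg n).lt_iff_ne.trans ne_comm

theorem num_le_add_left (m n : M.Num) : m ≤ n + m := ⟨n, add_comm _ _⟩

theorem num_le_add_right (m n : M.Num) : m ≤ m + n := ⟨n, rfl⟩

theorem num_le_mul_right {m n : M.Num} (hn : 0 < n) : m ≤ m * n := by
  obtain ⟨d, rfl⟩ := (Arith.lt_iff 0 n).1 hn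
  exact ⟨m * d, by ring⟩

/-! ### Pairs -/

omit hM in
theorem pair_eq (i j : M.Num) : M.pair i j = (i + j) * (i + j) + i := rfl

theorem num_le_mul_self (n : M.Num) : n ≤ n * n := by
  obtain rfl | h := eq_or_ne n 0
  · simp
  · exact num_le_mul_right ((num_pos_iff n).2 h)

theorem left_le_pair (i j : M.Num) : i ≤ M.pair i j := num_le_add_left _ _

theorem right_le_pair (i j : M.Num) : j ≤ M.pair i j :=
  ((num_le_add_left j i).trans (num_le_mul_self _)).trans (num_le_add_right _ _)

theorem pair_mono {i j i' j' : M.Num} (hi : i ≤ i') (hj : j ≤ j') :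
    M.pair i j ≤ M.pair i' j' := by
  obtain ⟨d, rfl⟩ := hi
  obtain ⟨e, rfl⟩ := hj
  exact ⟨(i + j) * (d + e) + (d + e) * (i + j) + (d + e) * (d + e) + d, by
    simp only [pair_eq]; ring⟩

/-- With `s = i + j` the code is `s² + i < (s + 1)²`, so codes with different sums never overlap. -/
theorem pair_lt_of_add_lt {i j i' j' : M.Num} (h : i + j < i' + j') : M.pair i j < M.pair i' j' := by
  obtain ⟨d, hd⟩ := (Arith.lt_iff _ _).1 h
  rw [pair_eq, pair_eq, hd, Arith.lt_iff]
  exact ⟨i + j + j + 2 * ((i + j) * d) + d * d + 2 * d + i', by ring⟩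

theorem pair_inj {i j i' j' : M.Num} (h : M.pair i j = M.pair i' j') : i = i' ∧ j = j' := by
  have hs : i + j = i' + j' := by
    rcases lt_trichotomy (i + j) (i' + j') with h' | h' | h'
    · exact absurd h (pair_lt_of_add_lt h').ne
    · exact h'
    · exact absurd h (pair_lt_of_add_lt h').ne'
  rw [pair_eq, pair_eq, hs] at h
  have hi := add_left_cancel h
  rw [hi] at hs
  exact ⟨hi, add_left_cancel hs⟩

theorem pair_eq_iff {i j i' j' : M.Num} : M.pair i j = M.pair i' j' ↔ i = i' ∧ j = j' :=
  ⟨pair_inj, by rintro ⟨rfl, rfl⟩; rfl⟩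

/-- This makes `M.pair n 0` a strict bound for the graph of every binary sequence of length at most
`n`. -/
theorem pair_lt_pair_zero {i b n : M.Num} (hi : i < n) (hb : b = 0 ∨ b = 1) :
    M.pair i b < M.pair n 0 := by
  have h : i + b ≤ n := by
    rcases hb with rfl | rfl
    · rw [add_zero]; exact hi.le
    · exact (add_one_le_iff' _ _).2 hi
  obtain ⟨d, hd⟩ := h
  obtain ⟨c, hc⟩ := (Arith.lt_iff _ _).1 hi
  rw [pair_eq, pair_eq, add_zero, Arith.lt_iff]
  refine ⟨2 * ((i + b) * d) + d * d + c, ?_⟩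
  calc n * n + n = (i + b + d) * (i + b + d) + (i + c + 1) := by rw [← hd, ← hc]
    _ = _ := by ring

instance TermDef.pair (f g : M.Env → M.Num) [TermDef f] [TermDef g] :
    TermDef (fun e : M.Env => M.pair (f e) (g e)) :=
  (inferInstance : TermDef (fun e : M.Env => (f e + g e) * (f e + g e) + f e))

/-! ### Divisibility -/

theorem le_of_dvd' {m n : M.Num} (hn : 0 < n) (h : m ∣ n) : m ≤ n := by
  obtain ⟨d, rfl⟩ := h
  refine num_le_mul_right ((num_pos_iff d).2 ?_)
  rintro rfl
  simp at hn

instance BddDef.dvd (f g : M.Env → M.Num) [TermDef f] [TermDef g] :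
    BddDef (fun e : M.Env => f e ∣ g e) :=
  (inferInstance : BddDef (fun e : M.Env => ∃ q, q ≤ g e ∧ g e = f e * q)).congr fun e => by
    refine ⟨fun ⟨q, hq⟩ => ?_, fun ⟨q, _, hq⟩ => ⟨q, hq⟩⟩
    obtain h | h := eq_or_ne (g e) 0
    · exact ⟨0, num_nonneg _, by rw [h, mul_zero]⟩
    · exact ⟨q, le_of_dvd' ((num_pos_iff _).2 h) ⟨f e, by rw [hq, mul_comm]⟩, hq⟩

theorem dvd_of_dvd_add {a b c : M.Num} (ha : 0 < a) (hb : a ∣ b) (h : a ∣ b + c) : a ∣ c := by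
  obtain ⟨u, rfl⟩ := hb
  obtain ⟨v, hv⟩ := h
  have huv : u ≤ v := by
    refine le_of_mul_le_mul_left ?_ ha
    rw [← hv]
    exact num_le_add_right _ _
  obtain ⟨w, rfl⟩ := huv
  exact ⟨w, add_left_cancel (hv.trans (by ring))⟩

theorem exists_common_multiple (k : M.Num) : ∃ n : M.Num, 0 < n ∧ ∀ d, d ≤ k → 0 < d → d ∣ n := by
  refine induct (fun k : M.Num => ∃ n : M.Num, 0 < n ∧ ∀ d, d ≤ k → 0 < d → d ∣ n) ?_ ?_ k
  · exact ⟨1, zero_lt_one, fun d hd hd' => absurd hd (not_le.2 hd')⟩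
  · rintro k ⟨n, hn, h⟩
    refine ⟨n * (k + 1), mul_pos hn ((lt_add_one_iff' _ _).2 (num_nonneg k)), fun d hd hd' => ?_⟩
    obtain rfl | hd := hd.eq_or_lt
    · exact dvd_mul_left _ _
    · exact (h d ((lt_add_one_iff' _ _).1 hd) hd').mul_right _

theorem beta_pos (n i : M.Num) : 0 < n * (i + 1) + 1 := (lt_add_one_iff' _ _).2 (num_nonneg _)

theorem exists_beta_multiple (n k : M.Num) :
    ∃ a : M.Num, 0 < a ∧ ∀ i, i < k → n * (i + 1) + 1 ∣ a := by
  refine induct (fun k : M.Num => ∃ a : M.Num, 0 < a ∧ ∀ i, i < k → n * (i + 1) + 1 ∣ a) ?_ ?_ k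
  · exact ⟨1, zero_lt_one, fun i hi => absurd hi (Arith.basic.not_lt_zero i)⟩
  · rintro k ⟨a, ha, h⟩
    refine ⟨a * (n * (k + 1) + 1), mul_pos ha (beta_pos _ _), fun i hi => ?_⟩
    obtain rfl | hi := ((lt_add_one_iff' _ _).1 hi).eq_or_lt
    · exact dvd_mul_left _ _
    · exact (h i hi).mul_right _

/-- The modulus is `1` modulo `n`: its multiple `(n * (i + 1) + 1) * x` is `n * x * (i + 1) + x`,
and the first summand is divisible by hypothesis. -/
theorem beta_dvd_of_dvd_mul {n i x : M.Num} (h : n * (i + 1) + 1 ∣ n * x) :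
    n * (i + 1) + 1 ∣ x :=
  dvd_of_dvd_add (beta_pos n i) (h.mul_right (i + 1)) ⟨x, by ring⟩

/-- Coprimality of distinct moduli, in the form of a cancellation law. The moduli differ by `n * d`
with `0 < d ≤ k`, so the first divides `n * (d * x)`. As `d ∣ n`, it divides `n * (n * x)`, and both
factors `n` cancel. -/
theorem beta_dvd_of_dvd_beta_mul {n k i j x : M.Num} (hn : ∀ d, d ≤ k → 0 < d → d ∣ n)
    (hi : i < k) (hj : j < k) (hij : i ≠ j) (h : n * (i + 1) + 1 ∣ (n * (j + 1) + 1) * x) :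
    n * (i + 1) + 1 ∣ x := by
  have key : ∃ d, 0 < d ∧ d ≤ k ∧ n * (i + 1) + 1 ∣ n * (d * x) := by
    rcases lt_or_gt_of_ne hij with h' | h'
    · obtain ⟨d, rfl⟩ := (Arith.lt_iff _ _).1 h'
      refine ⟨d + 1, (lt_add_one_iff' _ _).2 (num_nonneg d), hj.le.trans' ⟨i, by ring⟩,
        dvd_of_dvd_add (beta_pos n i) (dvd_mul_right _ x) ?_⟩
      convert h using 1
      ring
    · obtain ⟨d, rfl⟩ := (Arith.lt_iff _ _).1 h'
      refine ⟨d + 1, (lt_add_one_iff' _ _).2 (num_nonneg d), hi.le.trans' ⟨j, by ring⟩,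
        dvd_of_dvd_add (beta_pos n _) h ⟨x, by ring⟩⟩
  obtain ⟨d, hd, hdk, h⟩ := key
  exact beta_dvd_of_dvd_mul (beta_dvd_of_dvd_mul
    (h.trans (mul_dvd_mul_left n (mul_dvd_mul_right (hn d hdk hd) x))))

/-- Bounded `Σ⁰₁` comprehension: the elements below `k` of a `Σ⁰₁` class are coded by divisibility,
with a code that divides nothing more than needed. -/
theorem exists_beta_code {n k a : M.Num} (hn0 : 0 < n) (hn : ∀ d, d ≤ k → 0 < d → d ∣ n)
    (ha0 : 0 < a) (ha : ∀ i, i < k → n * (i + 1) + 1 ∣ a) (p : M.Num → Prop)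
    [hp : SigmaDef (fun e : M.Env => p (e 0))] :
    ∃ c, c ≤ a ∧ ∀ i, i < k → (n * (i + 1) + 1 ∣ c ↔ p i) := by
  have hp' : SigmaDef (fun e : M.Env =>
      ¬ (0 < e 0 ∧ ∀ i, i < k → p i → n * (i + 1) + 1 ∣ e 0)) := by
    have hp1 : SigmaDef (fun e : M.Env => p (e 0)) := hp
    refine (inferInstance : SigmaDef (fun e : M.Env =>
      ¬ 0 < e 0 ∨ ∃ i, i < k ∧ p i ∧ ¬ n * (i + 1) + 1 ∣ e 0)).congr fun e => ?_
    rw [not_and_or]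
    push Not
    rfl
  -- The code is the least positive common multiple of the moduli of the `i` satisfying `p`. Being
  -- such a multiple is a `Π⁰₁` condition when `p` is `Σ⁰₁`.
  obtain ⟨c, ⟨hc0, hc⟩, hmin⟩ := exists_least
    (fun c => 0 < c ∧ ∀ i, i < k → p i → n * (i + 1) + 1 ∣ c) ⟨a, ha0, fun i hi _ => ha i hi⟩
  refine ⟨c, not_lt.1 fun h => hmin a h ⟨ha0, fun i hi _ => ha i hi⟩,
    fun i hi => ⟨fun h => ?_, hc i hi⟩⟩
  by_contra hpi
  obtain ⟨b, rfl⟩ := h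
  have hb0 : 0 < b := (num_pos_iff b).2 (by rintro rfl; simp at hc0)
  -- An unwanted modulus can be divided out: the quotient `b` is smaller, and by coprimality it
  -- keeps the required divisors.
  refine hmin b ?_ ⟨hb0, fun j hj hpj => ?_⟩
  · rw [Arith.lt_iff]
    obtain ⟨n', rfl⟩ := (Arith.lt_iff _ _).1 hn0
    obtain ⟨b', rfl⟩ := (Arith.lt_iff _ _).1 hb0
    exact ⟨(n' + 1) * (i + 1) * b' + n' * (i + 1) + i, by ring⟩
  · have hji : j ≠ i := by rintro rfl; exact hpi hpj
    exact beta_dvd_of_dvd_beta_mul hn hj hi hji (hc j hj hpj)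

/-! ### Codes of finite sets -/

theorem mem_finSet_pair {x k m n : M.Num} :
    x ∈ M.finSet (M.pair k (M.pair m n)) ↔ x < k ∧ m * (x + 1) + 1 ∣ n := by
  constructor
  · rintro ⟨k', m', n', h, hx, q, hq⟩
    rw [pair_eq_iff, pair_eq_iff] at h
    rw [h.1, h.2.1, h.2.2]
    exact ⟨hx, q, by rw [hq, mul_comm]⟩
  · rintro ⟨hx, q, hq⟩
    exact ⟨k, m, n, rfl, hx, q, by rw [hq, mul_comm]⟩

theorem isTriple_iff (c : M.Num) : M.IsTriple c ↔
    ∃ k, k ≤ c ∧ ∃ m, m ≤ c ∧ ∃ n, n ≤ c ∧ c = M.pair k (M.pair m n) := by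
  constructor
  · rintro ⟨k, m, n, rfl⟩
    exact ⟨k, left_le_pair _ _, m, (left_le_pair _ _).trans (right_le_pair _ _), n,
      (right_le_pair _ _).trans (right_le_pair _ _), rfl⟩
  · rintro ⟨k, -, m, -, n, -, h⟩
    exact ⟨k, m, n, h⟩

theorem mem_finSet_iff (x c : M.Num) : x ∈ M.finSet c ↔
    ∃ k, k ≤ c ∧ ∃ m, m ≤ c ∧ ∃ n, n ≤ c ∧
      (c = M.pair k (M.pair m n) ∧ x < k ∧ m * (x + 1) + 1 ∣ n) := by
  constructor
  · rintro ⟨k, m, n, rfl, hx, q, hq⟩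
    exact ⟨k, left_le_pair _ _, m, (left_le_pair _ _).trans (right_le_pair _ _), n,
      (right_le_pair _ _).trans (right_le_pair _ _), rfl, hx, q, by rw [hq, mul_comm]⟩
  · rintro ⟨k, -, m, -, n, -, rfl, h⟩
    exact mem_finSet_pair.2 h

theorem lt_of_mem_finSet {x c : M.Num} (h : x ∈ M.finSet c) : x < c := by
  obtain ⟨k, m, n, rfl, hx, -⟩ := h
  exact hx.trans_le (left_le_pair _ _)

theorem finSet_subset_iff (c d : M.Num) :
    M.finSet c ⊆ M.finSet d ↔ ∀ x, x < c → x ∈ M.finSet c → x ∈ M.finSet d :=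
  ⟨fun h _ _ hx => h hx, fun h x hx => h x (lt_of_mem_finSet hx) hx⟩

instance BddDef.isTriple (f : M.Env → M.Num) [TermDef f] :
    BddDef (fun e : M.Env => M.IsTriple (f e)) :=
  (inferInstance : BddDef (fun e : M.Env => ∃ k, k ≤ f e ∧ ∃ m, m ≤ f e ∧ ∃ n, n ≤ f e ∧
    f e = M.pair k (M.pair m n))).congr fun e => isTriple_iff (f e)

instance BddDef.mem_finSet (f g : M.Env → M.Num) [TermDef f] [TermDef g] :
    BddDef (fun e : M.Env => f e ∈ M.finSet (g e)) :=
  (inferInstance : BddDef (fun e : M.Env => ∃ k, k ≤ g e ∧ ∃ m, m ≤ g e ∧ ∃ n, n ≤ g e ∧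
    (g e = M.pair k (M.pair m n) ∧ f e < k ∧ m * (f e + 1) + 1 ∣ n))).congr
      fun e => mem_finSet_iff (f e) (g e)

instance BddDef.finSet_subset (f g : M.Env → M.Num) [TermDef f] [TermDef g] :
    BddDef (fun e : M.Env => M.finSet (f e) ⊆ M.finSet (g e)) :=
  (inferInstance : BddDef (fun e : M.Env =>
    ∀ x, x < f e → x ∈ M.finSet (f e) → x ∈ M.finSet (g e))).congr
      fun e => finSet_subset_iff (f e) (g e)

instance BddDef.isFinSetCode (f : M.Env → M.Num) [TermDef f] :
    BddDef (fun e : M.Env => M.IsFinSetCode (f e)) :=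
  (inferInstance : BddDef (fun e : M.Env => M.IsTriple (f e) ∧ ∀ d, d < f e → M.IsTriple d →
    ¬ (M.finSet d ⊆ M.finSet (f e) ∧ M.finSet (f e) ⊆ M.finSet d))).congr fun e => by
      simp only [← Set.Subset.antisymm_iff]
      rfl

theorem exists_isFinSetCode_le {d : M.Num} (hd : M.IsTriple d) :
    ∃ s, s ≤ d ∧ M.IsFinSetCode s ∧ M.finSet s = M.finSet d := by
  obtain ⟨s, ⟨hs, h, h'⟩, hmin⟩ := exists_least (fun s : M.Num =>
    M.IsTriple s ∧ M.finSet s ⊆ M.finSet d ∧ M.finSet d ⊆ M.finSet s)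
    ⟨d, hd, subset_rfl, subset_rfl⟩
  have hsd := h.antisymm h'
  refine ⟨s, not_lt.1 fun h => hmin d h ⟨hd, subset_rfl, subset_rfl⟩, ⟨hs, fun t ht htt h => ?_⟩,
    hsd⟩
  rw [hsd] at h
  exact hmin t ht ⟨htt, h.subset, h.symm.subset⟩

theorem IsFinSetCode.eq {s t : M.Num} (hs : M.IsFinSetCode s) (ht : M.IsFinSetCode t)
    (h : M.finSet s = M.finSet t) : s = t := by
  rcases lt_trichotomy s t with h' | h' | h'
  · exact absurd h (ht.2 s h' hs.1)
  · exact h'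
  · exact absurd h.symm (hs.2 t h' ht.1)

/-- `B` exceeds some triple `(k, (n, a))` from which codes of all subsets of `{i | i < k}` arise by
decreasing `a`. -/
def IsCodeBound (k B : M.Num) : Prop :=
  ∃ n, n < B ∧ ∃ a, a < B ∧ (M.pair k (M.pair n a) < B ∧ 0 < n ∧ 0 < a ∧
    (∀ d, d ≤ k → 0 < d → d ∣ n) ∧ ∀ i, i < k → n * (i + 1) + 1 ∣ a)

instance BddDef.isCodeBound (f g : M.Env → M.Num) [TermDef f] [TermDef g] :
    BddDef (fun e : M.Env => IsCodeBound (f e) (g e)) := by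
  unfold IsCodeBound
  infer_instance

theorem exists_isCodeBound (k : M.Num) : ∃ B, IsCodeBound k B := by
  obtain ⟨n, hn, hd⟩ := exists_common_multiple k
  obtain ⟨a, ha, h⟩ := exists_beta_multiple n k
  have hp := right_le_pair k (M.pair n a)
  exact ⟨M.pair k (M.pair n a) + 1, n, (lt_add_one_iff' _ _).2 ((left_le_pair n a).trans hp), a,
    (lt_add_one_iff' _ _).2 ((right_le_pair n a).trans hp), lt_add_one' _, hn, ha, hd, h⟩

theorem IsCodeBound.lt {k B : M.Num} (h : IsCodeBound k B) : k < B := by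
  obtain ⟨n, -, a, -, h, -⟩ := h
  exact (left_le_pair _ _).trans_lt h

/-- The bound `B` does not depend on `p`: lowering the last entry of the triple from `a` to `c ≤ a`,
and then passing to the least code of the same set, only decreases the code. -/
theorem IsCodeBound.exists_isFinSetCode {k B : M.Num} (h : IsCodeBound k B) (p : M.Num → Prop)
    [SigmaDef (fun e : M.Env => p (e 0))] :
    ∃ s, s < B ∧ M.IsFinSetCode s ∧ ∀ x, x ∈ M.finSet s ↔ x < k ∧ p x := by
  obtain ⟨n, -, a, -, hB, hn, ha, hd, hi⟩ := h
  obtain ⟨c, hc, h⟩ := exists_beta_code hn hd ha hi p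
  obtain ⟨s, hs, hcode, hset⟩ := exists_isFinSetCode_le ⟨k, n, c, rfl⟩
  refine ⟨s, (hs.trans (pair_mono le_rfl (pair_mono le_rfl hc))).trans_lt hB, hcode, fun x => ?_⟩
  rw [hset, mem_finSet_pair]
  exact and_congr_right (h x)

/-! ### Binary sequences -/

theorem isBinSeq_iff (s l : M.Num) : M.IsBinSeq s l ↔ M.IsFinSetCode s ∧
    (∀ x, x < s → x ∈ M.finSet s → ∃ i, i < l ∧ (x = M.pair i 0 ∨ x = M.pair i 1)) ∧
    ∀ i, i < l → (M.pair i 0 ∈ M.finSet s ↔ ¬ M.pair i 1 ∈ M.finSet s) := by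
  constructor
  · rintro ⟨hc, hm, hv⟩
    refine ⟨hc, fun x _ hx => ?_, fun i hi => ?_⟩
    · obtain ⟨i, b, rfl, hi, rfl | rfl⟩ := hm x hx
      exacts [⟨i, hi, .inl rfl⟩, ⟨i, hi, .inr rfl⟩]
    · obtain ⟨b, hb, hu⟩ := hv i hi
      constructor
      · exact fun h0 h1 => zero_ne_one ((hu 0 h0).trans (hu 1 h1).symm)
      · intro h1
        obtain ⟨i', b', h, -, hb'⟩ := hm _ hb
        obtain ⟨-, rfl⟩ := pair_inj h
        obtain rfl | rfl := hb'
        · exact hb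
        · exact absurd hb h1
  · rintro ⟨hc, hm, hv⟩
    have hm' : ∀ x ∈ M.finSet s, ∃ i, i < l ∧ (x = M.pair i 0 ∨ x = M.pair i 1) :=
      fun x hx => hm x (lt_of_mem_finSet hx) hx
    refine ⟨hc, fun x hx => ?_, fun i hi => ?_⟩
    · obtain ⟨i, hi, rfl | rfl⟩ := hm' x hx
      exacts [⟨i, 0, rfl, hi, .inl rfl⟩, ⟨i, 1, rfl, hi, .inr rfl⟩]
    · have hb : ∀ b, M.pair i b ∈ M.finSet s → b = 0 ∨ b = 1 := fun b h => by
        obtain ⟨i, -, h | h⟩ := hm' _ h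
        exacts [.inl (pair_inj h).2, .inr (pair_inj h).2]
      by_cases h1 : M.pair i 1 ∈ M.finSet s
      · refine ⟨1, h1, fun b h => (hb b h).resolve_left ?_⟩
        rintro rfl
        exact (hv i hi).1 h h1
      · refine ⟨0, (hv i hi).2 h1, fun b h => (hb b h).resolve_right ?_⟩
        rintro rfl
        exact h1 h

instance BddDef.isBinSeq (f g : M.Env → M.Num) [TermDef f] [TermDef g] :
    BddDef (fun e : M.Env => M.IsBinSeq (f e) (g e)) :=
  (inferInstance : BddDef (fun e : M.Env => M.IsFinSetCode (f e) ∧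
    (∀ x, x < f e → x ∈ M.finSet (f e) → ∃ i, i < g e ∧ (x = M.pair i 0 ∨ x = M.pair i 1)) ∧
    ∀ i, i < g e → (M.pair i 0 ∈ M.finSet (f e) ↔ ¬ M.pair i 1 ∈ M.finSet (f e)))).congr
      fun e => isBinSeq_iff (f e) (g e)

theorem IsBinSeq.pair_zero_mem {s l i : M.Num} (h : M.IsBinSeq s l) (hi : i < l) :
    M.pair i 0 ∈ M.finSet s ↔ ¬ M.pair i 1 ∈ M.finSet s :=
  ((isBinSeq_iff s l).1 h).2.2 i hi

theorem IsBinSeq.lt_length {s l i b : M.Num} (h : M.IsBinSeq s l) (hi : M.pair i b ∈ M.finSet s) :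
    i < l := by
  obtain ⟨j, c, h, hj, -⟩ := h.mem _ hi
  rwa [(pair_inj h).1]

theorem IsBinSeq.subset_iff {s t l m : M.Num} (hs : M.IsBinSeq s l) (ht : M.IsBinSeq t m) :
    M.finSet s ⊆ M.finSet t ↔
      l ≤ m ∧ ∀ i, i < l → (M.pair i 1 ∈ M.finSet s ↔ M.pair i 1 ∈ M.finSet t) := by
  constructor
  · intro h
    have hlm : l ≤ m := by
      by_contra! hlm
      obtain ⟨b, hb, -⟩ := hs.value m hlm
      exact lt_irrefl _ (ht.lt_length (h hb))
    refine ⟨hlm, fun i hi => ⟨fun h' => h h', fun h' => ?_⟩⟩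
    by_contra h1
    exact (ht.pair_zero_mem (hi.trans_le hlm)).1 (h ((hs.pair_zero_mem hi).2 h1)) h'
  · rintro ⟨hlm, h⟩ x hx
    obtain ⟨i, b, rfl, hi, rfl | rfl⟩ := hs.mem x hx
    · rw [hs.pair_zero_mem hi, h i hi] at hx
      exact (ht.pair_zero_mem (hi.trans_le hlm)).2 hx
    · exact (h i hi).1 hx

theorem IsBinSeq.length_unique {s l m : M.Num} (h : M.IsBinSeq s l) (h' : M.IsBinSeq s m) :
    l = m :=
  ((h.subset_iff h').1 subset_rfl).1.antisymm ((h'.subset_iff h).1 subset_rfl).1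

theorem IsBinSeq.ext {s t l : M.Num} (hs : M.IsBinSeq s l) (ht : M.IsBinSeq t l)
    (h : ∀ i, i < l → (M.pair i 1 ∈ M.finSet s ↔ M.pair i 1 ∈ M.finSet t)) : s = t :=
  hs.code.eq ht.code (((hs.subset_iff ht).2 ⟨le_rfl, h⟩).antisymm
    ((ht.subset_iff hs).2 ⟨le_rfl, fun i hi => (h i hi).symm⟩))

theorem IsBinSeq.length_le {s l : M.Num} (h : M.IsBinSeq s l) : l ≤ s := by
  by_contra! hl
  obtain ⟨b, hb, -⟩ := h.value s hl
  exact absurd (lt_of_mem_finSet hb) (not_lt.2 (left_le_pair s b))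

/-- `B` exceeds the codes of all binary sequences of length at most `n`. -/
def IsSeqBound (n B : M.Num) : Prop := IsCodeBound (M.pair n 0) B

instance BddDef.isSeqBound (f g : M.Env → M.Num) [TermDef f] [TermDef g] :
    BddDef (fun e : M.Env => IsSeqBound (f e) (g e)) := by
  unfold IsSeqBound
  infer_instance

theorem exists_isSeqBound (n : M.Num) : ∃ B, IsSeqBound n B := exists_isCodeBound _

theorem IsSeqBound.lt {n B : M.Num} (h : IsSeqBound n B) : n < B :=
  (left_le_pair n 0).trans_lt (IsCodeBound.lt h)

theorem IsSeqBound.exists_isBinSeq {n l B : M.Num} (h : IsSeqBound n B) (hl : l ≤ n)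
    (p : M.Num → Prop) [BddDef (fun e : M.Env => p (e 0))] :
    ∃ s, s < B ∧ M.IsBinSeq s l ∧ ∀ i, i < l → (M.pair i 1 ∈ M.finSet s ↔ p i) := by
  obtain ⟨s, hs, hc, h⟩ := IsCodeBound.exists_isFinSetCode h (fun x : M.Num =>
    ∃ i, i < l ∧ (x = M.pair i 1 ∧ p i ∨ x = M.pair i 0 ∧ ¬ p i))
  have hone : ∀ i, i < l → (M.pair i 1 ∈ M.finSet s ↔ p i) := by
    intro i hi
    rw [h]
    constructor
    · rintro ⟨-, j, -, ⟨hj, hp⟩ | ⟨hj, -⟩⟩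
      · rwa [(pair_inj hj).1]
      · exact absurd (pair_inj hj).2 one_ne_zero
    · exact fun hp => ⟨pair_lt_pair_zero (hi.trans_le hl) (.inr rfl), i, hi, .inl ⟨rfl, hp⟩⟩
  have hzero : ∀ i, i < l → (M.pair i 0 ∈ M.finSet s ↔ ¬ p i) := by
    intro i hi
    rw [h]
    constructor
    · rintro ⟨-, j, -, ⟨hj, -⟩ | ⟨hj, hp⟩⟩
      · exact absurd (pair_inj hj).2 zero_ne_one
      · rwa [(pair_inj hj).1]
    · exact fun hp => ⟨pair_lt_pair_zero (hi.trans_le hl) (.inl rfl), i, hi, .inr ⟨rfl, hp⟩⟩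
  refine ⟨s, hs, (isBinSeq_iff s l).2 ⟨hc, fun x _ hx => ?_, fun i hi => ?_⟩, hone⟩
  · obtain ⟨-, i, hi, ⟨hx, -⟩ | ⟨hx, -⟩⟩ := (h x).1 hx
    exacts [⟨i, hi, .inr hx⟩, ⟨i, hi, .inl hx⟩]
  · rw [hzero i hi, hone i hi]

theorem exists_isBinSeq (l : M.Num) (p : M.Num → Prop) [BddDef (fun e : M.Env => p (e 0))] :
    ∃ s, M.IsBinSeq s l ∧ ∀ i, i < l → (M.pair i 1 ∈ M.finSet s ↔ p i) := by
  obtain ⟨B, hB⟩ := exists_isSeqBound l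
  obtain ⟨s, -, h⟩ := hB.exists_isBinSeq le_rfl p
  exact ⟨s, h⟩

/-- The construction below `B` produces a sequence with the same bits, and codes of sequences are
unique. -/
theorem IsSeqBound.code_lt {n l B s : M.Num} (h : IsSeqBound n B) (hs : M.IsBinSeq s l)
    (hl : l ≤ n) : s < B := by
  obtain ⟨t, htB, ht, hts⟩ := h.exists_isBinSeq hl (fun i : M.Num => M.pair i 1 ∈ M.finSet s)
  rwa [← ht.ext hs hts]

theorem IsBinSeq.exists_restrict {t l n : M.Num} (ht : M.IsBinSeq t l) (hn : n ≤ l) :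
    ∃ r, r ≤ t ∧ M.IsBinSeq r n ∧ M.finSet r ⊆ M.finSet t := by
  obtain ⟨k, m, a, rfl⟩ := ht.code.1
  -- In the graph of `t`, the pairs with index below `n` are exactly those below `M.pair n 0`.
  -- Cutting off there keeps `m` and `a`, so the code does not grow.
  obtain ⟨r, hr, hrc, hset⟩ := exists_isFinSetCode_le (M := M)
    ⟨min k (M.pair n 0), m, a, rfl⟩
  have hmem : ∀ x, x ∈ M.finSet r ↔ x ∈ M.finSet (M.pair k (M.pair m a)) ∧ x < M.pair n 0 := by
    intro x
    rw [hset, mem_finSet_pair, mem_finSet_pair, lt_min_iff]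
    tauto
  refine ⟨r, hr.trans (pair_mono (min_le_left _ _) le_rfl), (isBinSeq_iff _ _).2 ⟨hrc, ?_, ?_⟩,
    fun x hx => ((hmem x).1 hx).1⟩
  · intro x _ hx
    obtain ⟨hx, hxn⟩ := (hmem x).1 hx
    obtain ⟨i, b, rfl, -, hb⟩ := ht.mem x hx
    have hi : i < n := by
      by_contra! hi
      exact absurd hxn (not_lt.2 (pair_mono hi (num_nonneg b)))
    exact ⟨i, hi, by obtain rfl | rfl := hb <;> simp⟩
  · intro i hi
    rw [hmem, hmem, and_iff_left (pair_lt_pair_zero hi (.inl rfl)),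
      and_iff_left (pair_lt_pair_zero hi (.inr rfl))]
    exact ht.pair_zero_mem (hi.trans_le hn)

/-! ### Comprehension for sets and binary relations. -/

theorem exists_set (p : M.Num → Prop) [hp : SigmaDef (fun e : M.Env => p (e 0))]
    [hp' : SigmaDef (fun e : M.Env => ¬ p (e 0))] : ∃ Y ∈ M.sets, ∀ n, n ∈ Y ↔ p n :=
  hM.out.comprehension.exists_set p hp hp'

theorem exists_set_pairs (p : M.Num → M.Num → Prop)
    [hp : BddDef (fun e : M.Env => p (e 1) (e 0))] :
    ∃ Y ∈ M.sets, (∀ x y, M.pair x y ∈ Y ↔ p x y) ∧ ∀ z ∈ Y, ∃ x y, z = M.pair x y := by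
  have hp1 : BddDef (fun e : M.Env => p (e 1) (e 0)) := hp
  obtain ⟨Y, hY, h⟩ := exists_set (fun z : M.Num =>
    ∃ x, x ≤ z ∧ ∃ y, y ≤ z ∧ (z = M.pair x y ∧ p x y))
  refine ⟨Y, hY, fun x y => ?_, fun z hz => ?_⟩
  · rw [h]
    constructor
    · rintro ⟨x', -, y', -, hxy, hp⟩
      obtain ⟨rfl, rfl⟩ := pair_inj hxy
      exact hp
    · exact fun hp => ⟨x, left_le_pair _ _, y, right_le_pair _ _, rfl, hp⟩
  · obtain ⟨x, -, y, -, hxy, -⟩ := (h z).1 hz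
    exact ⟨x, y, hxy⟩

/-! ### From weak König's lemma to initial intervals -/

theorem IsPartialOrder.mem {P R : Set M.Num} (h : M.IsPartialOrder P R) {x y : M.Num}
    (hxy : M.pair x y ∈ R) : x ∈ P ∧ y ∈ P := by
  obtain ⟨x', hx, y', hy, h⟩ := h.subset _ hxy
  obtain ⟨rfl, rfl⟩ := pair_inj h
  exact ⟨hx, hy⟩

/-- The sequence `s` of length `l` looks like the characteristic function of an initial interval of
`(P, R)` which contains `D` and has no element strictly above an element of `D`. -/
def IsIntervalApprox (P R D : Set M.Num) (s l : M.Num) : Prop :=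
  M.IsBinSeq s l ∧ (∀ i, i < l → M.pair i 1 ∈ M.finSet s → i ∈ P) ∧
    (∀ i, i < l → i ∈ D → M.pair i 1 ∈ M.finSet s) ∧
    (∀ i, i < l → ∀ j, j < l → M.pair i j ∈ R → M.pair j 1 ∈ M.finSet s →
      M.pair i 1 ∈ M.finSet s) ∧
    ∀ i, i < l → ∀ j, j < l → i ∈ D → M.pair i j ∈ R → ¬ i = j → ¬ M.pair j 1 ∈ M.finSet s

/-- The downward closure of `D ∩ [0, l)`, cut off at `l`, is given by a bounded formula. If `i ∈ D`
lies below `j` and `j` below `x ∈ D`, the antichain condition gives `i = x`, and antisymmetry gives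
`i = j`. -/
theorem exists_isIntervalApprox {P R D : Set M.Num} (hP : M.IsPartialOrder P R)
    (hD : M.IsAntichain P R D) (l : M.Num) : ∃ s, IsIntervalApprox P R D s l := by
  have := Fact.mk hP.isSet_rel
  have := Fact.mk hD.isSet
  obtain ⟨s, hs, h⟩ := exists_isBinSeq l (fun i : M.Num => ∃ x, x < l ∧ (x ∈ D ∧ M.pair i x ∈ R))
  refine ⟨s, hs, fun i hi h' => ?_, fun i hi hiD => ?_, fun i hi j hj hij h' => ?_,
    fun i hi j hj hiD hij hne h' => ?_⟩
  · obtain ⟨x, -, -, hx⟩ := (h i hi).1 h'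
    exact (hP.mem hx).1
  · exact (h i hi).2 ⟨i, hi, hiD, hP.refl i (hD.subset hiD)⟩
  · obtain ⟨x, hxl, hxD, hx⟩ := (h j hj).1 h'
    exact (h i hi).2 ⟨x, hxl, hxD,
      hP.trans i (hP.mem hij).1 j (hP.mem hij).2 x (hP.mem hx).2 hij hx⟩
  · obtain ⟨x, hxl, hxD, hx⟩ := (h j hj).1 h'
    have hix := hP.trans i (hP.mem hij).1 j (hP.mem hij).2 x (hP.mem hx).2 hij hx
    have : i = x := by
      by_contra hne
      exact (hD.incomparable i hiD x hxD hne).1 hix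
    subst this
    exact hne (hP.antisymm i (hP.mem hij).1 j (hP.mem hij).2 hij hx)

theorem IsIntervalApprox.mono {P R D : Set M.Num} {s t l m : M.Num}
    (h : IsIntervalApprox P R D t m) (hs : M.IsBinSeq s l) (hst : M.finSet s ⊆ M.finSet t) :
    IsIntervalApprox P R D s l := by
  obtain ⟨ht, h1, h2, h3, h4⟩ := h
  obtain ⟨hlm, hb⟩ := (hs.subset_iff ht).1 hst
  refine ⟨hs, fun i hi h => h1 i (hi.trans_le hlm) (hst h),
    fun i hi h => (hb i hi).2 (h2 i (hi.trans_le hlm) h),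
    fun i hi j hj hij h => (hb i hi).2 (h3 i (hi.trans_le hlm) j (hj.trans_le hlm) hij (hst h)),
    fun i hi j hj hiD hij hne h =>
      h4 i (hi.trans_le hlm) j (hj.trans_le hlm) hiD hij hne (hst h)⟩

theorem WeakKonig.exists_initialInterval (hW : M.WeakKonig) {P R D : Set M.Num}
    (hP : M.IsPartialOrder P R) (hD : M.IsAntichain P R D) :
    ∃ I : Set M.Num, M.IsInitialInterval P R I ∧ D ⊆ I ∧
      ∀ x ∈ D, ∀ y ∈ I, ¬ M.StrictlyBelow R x y := by
  have := Fact.mk hP.isSet_dom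
  have := Fact.mk hP.isSet_rel
  have := Fact.mk hD.isSet
  have hdef : BddDef (fun e : M.Env => ∃ l, l ≤ e 0 ∧ IsIntervalApprox P R D (e 0) l) := by
    unfold IsIntervalApprox
    infer_instance
  -- A length never exceeds its code, so `l ≤ s` loses nothing and makes the condition bounded.
  obtain ⟨T, hT, hmem⟩ := exists_set (fun s : M.Num => ∃ l, l ≤ s ∧ IsIntervalApprox P R D s l)
  have hmem' : ∀ s l, IsIntervalApprox P R D s l → s ∈ T := fun s l h =>
    (hmem s).2 ⟨l, h.1.length_le, h⟩
  have htree : M.IsBinTree T := by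
    refine ⟨hT, fun s hs => ?_, fun s t l ht hs hst => ?_⟩
    · obtain ⟨l, -, h⟩ := (hmem s).1 hs
      exact ⟨l, h.1⟩
    · obtain ⟨m, -, h⟩ := (hmem t).1 ht
      exact hmem' s l (h.mono hs hst)
  have hinf : M.IsInfinite T := fun n => by
    obtain ⟨s, hs⟩ := exists_isIntervalApprox hP hD (n + 1)
    exact ⟨s, hmem' s _ hs, (lt_add_one' n).trans_le hs.1.length_le⟩
  obtain ⟨F, hF, hpath⟩ := hW T htree hinf
  have := Fact.mk hF.isSet
  obtain ⟨I, hI, hIF⟩ := exists_set (fun i : M.Num => M.pair i 1 ∈ F)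
  have key : ∀ n, ∃ s, IsIntervalApprox P R D s n ∧
      ∀ i, i < n → (M.pair i 1 ∈ M.finSet s ↔ i ∈ I) := by
    intro n
    obtain ⟨s, hsT, hs, h⟩ := hpath n
    obtain ⟨l, -, hl⟩ := (hmem s).1 hsT
    obtain rfl := hs.length_unique hl.1
    exact ⟨s, hl, fun i hi => (h i 1 hi).trans (hIF i).symm⟩
  have hlt : ∀ x y : M.Num, x < x + y + 1 ∧ y < x + y + 1 := fun x y =>
    ⟨(lt_add_one_iff' _ _).2 (num_le_add_right _ _), (lt_add_one_iff' _ _).2 (num_le_add_left _ _)⟩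
  refine ⟨I, ⟨hI, fun x hx => ?_, fun x _ y _ hxy hy => ?_⟩, fun x hx => ?_, fun x hx y hy => ?_⟩
  · obtain ⟨s, ⟨-, h, -⟩, hs⟩ := key (x + 1)
    exact h x (lt_add_one' x) ((hs x (lt_add_one' x)).2 hx)
  · obtain ⟨s, ⟨-, -, -, h, -⟩, hs⟩ := key (x + y + 1)
    obtain ⟨hx', hy'⟩ := hlt x y
    exact (hs x hx').1 (h x hx' y hy' hxy ((hs y hy').2 hy))
  · obtain ⟨s, ⟨-, -, h, -⟩, hs⟩ := key (x + 1)
    exact (hs x (lt_add_one' x)).1 (h x (lt_add_one' x) hx)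
  · rintro ⟨hxy, hne⟩
    obtain ⟨s, ⟨-, -, -, -, h⟩, hs⟩ := key (x + y + 1)
    obtain ⟨hx', hy'⟩ := hlt x y
    exact h x hx' y hy' hx hxy hne ((hs y hy').2 hy)

/-! ### Parity -/

theorem even_or_odd' (x : M.Num) : ∃ m, x = m + m ∨ x = m + m + 1 := by
  refine induct (fun x : M.Num => ∃ m, x = m + m ∨ x = m + m + 1) ⟨0, .inl (by ring)⟩ ?_ x
  rintro _ ⟨m, rfl | rfl⟩
  · exact ⟨m, .inr rfl⟩
  · exact ⟨m + 1, .inl (by ring)⟩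

theorem double_inj {m n : M.Num} : m + m = n + n ↔ m = n := by
  refine ⟨fun h => ?_, fun h => by rw [h]⟩
  rcases lt_trichotomy m n with h' | h' | h'
  · exact absurd h (add_lt_add h' h').ne
  · exact h'
  · exact absurd h (add_lt_add h' h').ne'

theorem double_ne_double_add_one {m n : M.Num} : m + m ≠ n + n + 1 := by
  rcases le_or_gt m n with h | h
  · exact (((lt_add_one_iff' _ _).2 (add_le_add h h))).ne
  · rw [← add_one_le_iff'] at h
    refine ne_of_gt (lt_of_lt_of_le ?_ (add_le_add h h))
    rw [Arith.lt_iff]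
    exact ⟨0, by ring⟩

/-! ### Separation of `Σ⁰₁` classes from initial intervals -/

/-- `m` is at most `l` and enters the class `{m | ∃ s, a m s}` by stage `l`. -/
def EntersBy (a : M.Num → M.Num → Prop) (m l : M.Num) : Prop := m ≤ l ∧ ∃ s, s ≤ l ∧ a m s

/-- `k` is the pair of `m` and the first stage at which `m` enters the class `{m | ∃ s, b m s}`. -/
def IsEntry (b : M.Num → M.Num → Prop) (k m : M.Num) : Prop :=
  ∃ s, s ≤ k ∧ (k = M.pair m s ∧ b m s ∧ ∀ t, t < s → ¬ b m t)

/-- `l` is the number which enters at `k`, or `k` itself if there is none. -/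
def IsLevel (b : M.Num → M.Num → Prop) (k l : M.Num) : Prop :=
  IsEntry b k l ∨ l = k ∧ ∀ m, m ≤ k → ¬ IsEntry b k m

/-- A partial order of the numbers in which the odd numbers form an antichain. An element of the
first class is below almost all odd numbers (when doubled), an element of the second class is above
some odd number. -/
def separationOrder (a b : M.Num → M.Num → Prop) (x y : M.Num) : Prop :=
  x = y ∨ (∃ m, m ≤ x ∧ ∃ n, n ≤ y ∧ (x = m + m ∧ y = n + n ∧ EntersBy a m n)) ∨
    (∃ m, m ≤ x ∧ ∃ k, k ≤ y ∧ (x = m + m ∧ y = k + k + 1 ∧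
      ∃ l, l ≤ k ∧ (IsLevel b k l ∧ EntersBy a m l))) ∨
    ∃ k, k ≤ x ∧ ∃ m, m ≤ y ∧ (x = k + k + 1 ∧ y = m + m ∧ IsEntry b k m)

section

variable {a b : M.Num → M.Num → Prop} {k l m n p : M.Num}

theorem EntersBy.trans (h : EntersBy a m n) (h' : n ≤ p) : EntersBy a m p := by
  obtain ⟨hm, s, hs, ha⟩ := h
  exact ⟨hm.trans h', s, hs.trans h', ha⟩

theorem IsEntry.unique (h : IsEntry b k m) (h' : IsEntry b k n) : m = n := by
  obtain ⟨s, -, rfl, -⟩ := h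
  obtain ⟨t, -, h, -⟩ := h'
  exact (pair_inj h).1

theorem IsEntry.le (h : IsEntry b k m) : m ≤ k := by
  obtain ⟨s, -, rfl, -⟩ := h
  exact left_le_pair _ _

/-- This is the purpose of levels: everything put below the odd number `k + k + 1` is already below
the even number that this odd number is put under. -/
theorem IsEntry.level_eq (h : IsEntry b k m) (h' : IsLevel b k l) : l = m := by
  obtain h' | ⟨-, h'⟩ := h'
  · exact h'.unique h
  · exact absurd h (h' m h.le)

theorem IsLevel.le (h : IsLevel b k l) : l ≤ k := by
  obtain h | ⟨rfl, -⟩ := h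
  exacts [h.le, le_rfl]

theorem exists_isLevel (b : M.Num → M.Num → Prop) (k : M.Num) : ∃ l, IsLevel b k l := by
  by_cases h : ∃ m, m ≤ k ∧ IsEntry b k m
  · obtain ⟨m, -, h⟩ := h
    exact ⟨m, .inl h⟩
  · exact ⟨k, .inr ⟨rfl, fun m hm hm' => h ⟨m, hm, hm'⟩⟩⟩

theorem separationOrder_even_even :
    separationOrder a b (m + m) (n + n) ↔ m = n ∨ EntersBy a m n := by
  constructor
  · rintro (h | ⟨m', -, n', -, h, h', he⟩ | ⟨m', -, n', -, h, h', -⟩ | ⟨m', -, n', -, h, -⟩)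
    · exact .inl (double_inj.1 h)
    · rw [double_inj] at h h'
      subst h h'
      exact .inr he
    · exact absurd h' double_ne_double_add_one
    · exact absurd h double_ne_double_add_one
  · rintro (rfl | h)
    · exact .inl rfl
    · exact .inr (.inl ⟨m, num_le_add_left _ _, n, num_le_add_left _ _, rfl, rfl, h⟩)

theorem separationOrder_even_odd :
    separationOrder a b (m + m) (k + k + 1) ↔ ∃ l, IsLevel b k l ∧ EntersBy a m l := by
  constructor
  · rintro (h | ⟨m', -, n', -, h, h', he⟩ | ⟨m', -, n', -, h, h', l, -, he⟩ | ⟨m', -, n', -, h, -⟩)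
    · exact absurd h double_ne_double_add_one
    · exact absurd h'.symm double_ne_double_add_one
    · rw [double_inj] at h
      replace h' := double_inj.1 (add_right_cancel h')
      subst h h'
      exact ⟨l, he⟩
    · exact absurd h double_ne_double_add_one
  · rintro ⟨l, hl, h⟩
    exact .inr (.inr (.inl ⟨m, num_le_add_left _ _, k,
      (num_le_add_left _ _).trans (lt_add_one' _).le, rfl, rfl, l, hl.le, hl, h⟩))

theorem separationOrder_odd_even :
    separationOrder a b (k + k + 1) (m + m) ↔ IsEntry b k m := by
  constructor
  · rintro (h | ⟨m', -, n', -, h, -⟩ | ⟨m', -, n', -, h, -⟩ | ⟨m', -, n', -, h, h', he⟩)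
    · exact absurd h.symm double_ne_double_add_one
    · exact absurd h.symm double_ne_double_add_one
    · exact absurd h.symm double_ne_double_add_one
    · rw [double_inj] at h'
      replace h := double_inj.1 (add_right_cancel h)
      subst h h'
      exact he
  · exact fun h => .inr (.inr (.inr ⟨k, (num_le_add_left _ _).trans (lt_add_one' _).le, m,
      num_le_add_left _ _, rfl, rfl, h⟩))

theorem separationOrder_odd_odd :
    separationOrder a b (k + k + 1) (l + l + 1) ↔ k = l := by
  constructor
  · rintro (h | ⟨m', -, n', -, h, -⟩ | ⟨m', -, n', -, h, -⟩ | ⟨m', -, n', -, h, h', -⟩)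
    · exact double_inj.1 (add_right_cancel h)
    · exact absurd h.symm double_ne_double_add_one
    · exact absurd h.symm double_ne_double_add_one
    · exact absurd h'.symm double_ne_double_add_one
  · rintro rfl
    exact .inl rfl

theorem not_entersBy_of_isEntry (hab : ∀ m s t, a m s → ¬ b m t) (h : IsEntry b k m) :
    ¬ EntersBy a m l := by
  obtain ⟨t, -, -, hb, -⟩ := h
  rintro ⟨-, s, -, ha⟩
  exact hab m s t ha hb

/-- Two cases use more than monotonicity of `EntersBy`. For even, odd, even, the level of the middle
element is the number that enters there. For odd, even, third, the middle number is in the second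
class, so by disjointness it is not below anything else via the first class. -/
theorem separationOrder_trans (hab : ∀ m s t, a m s → ¬ b m t) {x y z : M.Num}
    (hxy : separationOrder a b x y) (hyz : separationOrder a b y z) :
    separationOrder a b x z := by
  obtain ⟨i, rfl | rfl⟩ := even_or_odd' x <;> obtain ⟨j, rfl | rfl⟩ := even_or_odd' y <;>
    obtain ⟨k, rfl | rfl⟩ := even_or_odd' z <;>
    simp only [separationOrder_even_even, separationOrder_even_odd, separationOrder_odd_even,
      separationOrder_odd_odd] at *
  · obtain rfl | hxy := hxy
    · exact hyz
    · obtain rfl | hyz := hyz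
      · exact .inr hxy
      · exact .inr (hxy.trans hyz.1)
  · obtain rfl | hxy := hxy
    · exact hyz
    · obtain ⟨l, hl, hyz⟩ := hyz
      exact ⟨l, hl, hxy.trans hyz.1⟩
  · obtain ⟨l, hl, hxy⟩ := hxy
    rw [hyz.level_eq hl] at hxy
    exact .inr hxy
  · rwa [← hyz]
  · obtain rfl | hyz := hyz
    · exact hxy
    · exact absurd hyz (not_entersBy_of_isEntry hab hxy)
  · obtain ⟨l, -, hyz⟩ := hyz
    exact absurd hyz (not_entersBy_of_isEntry hab hxy)
  · rwa [hxy]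
  · exact hxy.trans hyz

theorem separationOrder_antisymm (hab : ∀ m s t, a m s → ¬ b m t) {x y : M.Num}
    (hxy : separationOrder a b x y) (hyx : separationOrder a b y x) : x = y := by
  obtain ⟨i, rfl | rfl⟩ := even_or_odd' x <;> obtain ⟨j, rfl | rfl⟩ := even_or_odd' y <;>
    simp only [separationOrder_even_even, separationOrder_even_odd, separationOrder_odd_even,
      separationOrder_odd_odd] at hxy hyx
  · obtain rfl | hxy := hxy
    · rfl
    · obtain rfl | hyx := hyx
      · rfl
      · rw [hxy.1.antisymm hyx.1]
  · obtain ⟨l, -, hxy⟩ := hxy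
    exact absurd hxy (not_entersBy_of_isEntry hab hyx)
  · obtain ⟨l, -, hyx⟩ := hyx
    exact absurd hyx (not_entersBy_of_isEntry hab hxy)
  · rw [hxy]

/-- Beyond some bound, all entries are of numbers which are not below `c`. -/
theorem exists_entry_bound (hb : BddDef (fun e : M.Env => b (e 1) (e 0))) (c : M.Num) :
    ∃ B, ∀ k m, m < c → IsEntry b k m → k ≤ B := by
  have hb' : BddDef (fun e : M.Env => b (e 0) (e 1)) :=
    BddDef.comp _ (fun i => match i with | 0 => 1 | 1 => 0 | i => i) (h := hb)
  have hb'' : SigmaDef (fun e : M.Env => ∃ s, b (e 0) s) := by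
    have : BddDef (fun e : M.Env => b (e 1) (e 0)) := hb
    exact ⟨fun s e => b (e 0) s, this, fun _ => Iff.rfl⟩
  obtain ⟨A, hA⟩ := exists_isCodeBound c
  obtain ⟨z, -, -, hz⟩ := hA.exists_isFinSetCode (fun m => ∃ s, b m s)
  -- Replacing membership in the second class below `c` by membership in its finite code `z` leaves
  -- a bounded formula, to which collection applies.
  obtain ⟨B, hB⟩ := collection (fun m s => m ∈ M.finSet z → b m s) c fun m hm => by
    by_cases h : m ∈ M.finSet z
    · obtain ⟨s, hs⟩ := ((hz m).1 h).2
      exact ⟨s, fun _ => hs⟩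
    · exact ⟨0, fun h' => absurd h' h⟩
  refine ⟨M.pair c B, ?_⟩
  rintro k m hm ⟨s, -, rfl, hbs, hmin⟩
  obtain ⟨t, ht, h⟩ := hB m hm
  refine pair_mono hm.le (le_trans (not_lt.1 fun hts => ?_) ht.le)
  exact hmin t hts (h ((hz m).2 ⟨hm, s, hbs⟩))

end

/-- If every infinite antichain `D` meets in an infinite set some initial interval with no element
strictly above an element of `D`, then disjoint `Σ⁰₁` classes can be separated. -/
theorem exists_separating_set
    (h3 : ∀ P R D : Set M.Num, M.IsPartialOrder P R → M.IsAntichain P R D → M.IsInfinite D →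
      ∃ I : Set M.Num, M.IsInitialInterval P R I ∧ M.IsInfinite (I ∩ D) ∧
        ∀ x ∈ D, ∀ y ∈ I, ¬ M.StrictlyBelow R x y)
    (a b : M.Num → M.Num → Prop)
    (ha : ∀ (f g : M.Env → M.Num) [TermDef f] [TermDef g], BddDef (fun e => a (f e) (g e)))
    (hb : ∀ (f g : M.Env → M.Num) [TermDef f] [TermDef g], BddDef (fun e => b (f e) (g e)))
    (hab : ∀ m s t, a m s → ¬ b m t) :
    ∃ X ∈ M.sets, ∀ m, ((∃ s, a m s) → m ∈ X) ∧ ((∃ s, b m s) → m ∉ X) := by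
  have hR : BddDef (fun e : M.Env => separationOrder a b (e 1) (e 0)) := by
    have hA : ∀ (f g : M.Env → M.Num) [TermDef f] [TermDef g],
        BddDef (fun e => EntersBy a (f e) (g e)) := fun f g _ _ => by
      unfold EntersBy
      infer_instance
    have hE : ∀ (f g : M.Env → M.Num) [TermDef f] [TermDef g],
        BddDef (fun e => IsEntry b (f e) (g e)) := fun f g _ _ => by
      unfold IsEntry
      infer_instance
    have hL : ∀ (f g : M.Env → M.Num) [TermDef f] [TermDef g],
        BddDef (fun e => IsLevel b (f e) (g e)) := fun f g _ _ => by
      unfold IsLevel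
      infer_instance
    unfold separationOrder
    infer_instance
  obtain ⟨R, hRs, hR, hR'⟩ := exists_set_pairs (separationOrder a b)
  obtain ⟨P, hPs, hP⟩ := exists_set (fun _ : M.Num => True)
  obtain ⟨D, hDs, hD⟩ := exists_set (fun x : M.Num => ∃ k, k ≤ x ∧ x = k + k + 1)
  have hDodd : ∀ k, k + k + 1 ∈ D := fun k =>
    (hD _).2 ⟨k, (num_le_add_left _ _).trans (lt_add_one' _).le, rfl⟩
  obtain ⟨I, ⟨hIs, -, hI⟩, hinf, hID⟩ := h3 P R D
    { isSet_dom := hPs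
      isSet_rel := hRs
      subset := fun z hz => by
        obtain ⟨x, y, rfl⟩ := hR' z hz
        exact ⟨x, (hP x).2 trivial, y, (hP y).2 trivial, rfl⟩
      refl := fun x _ => (hR x x).2 (.inl rfl)
      antisymm := fun x _ y _ hxy hyx =>
        separationOrder_antisymm hab ((hR x y).1 hxy) ((hR y x).1 hyx)
      trans := fun x _ y _ z _ hxy hyz =>
        (hR x z).2 (separationOrder_trans hab ((hR x y).1 hxy) ((hR y z).1 hyz)) }
    { isSet := hDs
      subset := fun x _ => (hP x).2 trivial
      incomparable := fun x hx y hy hxy => by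
        obtain ⟨k, -, rfl⟩ := (hD x).1 hx
        obtain ⟨l, -, rfl⟩ := (hD y).1 hy
        rw [hR, hR, separationOrder_odd_odd, separationOrder_odd_odd]
        exact ⟨fun h => hxy (by rw [h]), fun h => hxy (by rw [h])⟩ }
    fun n => ⟨n + n + 1, hDodd n, (lt_add_one_iff' _ _).2 (num_le_add_left _ _)⟩
  have := Fact.mk hIs
  obtain ⟨X, hXs, hX⟩ := exists_set (fun m : M.Num => m + m ∈ I)
  refine ⟨X, hXs, fun m => ⟨?_, ?_⟩⟩
  · rintro ⟨s, hs⟩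
    obtain ⟨B, hB⟩ := exists_entry_bound (hb (fun e => e 1) fun e => e 0) (m + s)
    -- The odd number is chosen so large that its index `k` exceeds `B + (m + s)`. Then its level is
    -- at least `m + s`: an entry with smaller value would have `k ≤ B`, and without an entry the
    -- level is `k`. Hence both `m` and the stage `s` are within the level.
    obtain ⟨x, ⟨hxI, hxD⟩, hx⟩ := hinf ((B + (m + s)) + (B + (m + s)) + 1)
    obtain ⟨k, -, rfl⟩ := (hD x).1 hxD
    have hk : B + (m + s) < k := by
      by_contra! hk
      exact absurd hx (not_lt.2 (add_le_add (add_le_add hk hk) le_rfl))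
    obtain ⟨l, hl⟩ := exists_isLevel b k
    have hml : m + s ≤ l := by
      by_contra! hlt
      obtain h | ⟨rfl, -⟩ := hl
      · exact absurd (hB k l hlt h) (not_le.2 (hk.trans_le' (num_le_add_right _ _)))
      · exact absurd hlt (not_lt.2 (hk.le.trans' (num_le_add_left _ _)))
    refine (hX m).2 (hI _ ((hP _).2 trivial) _ ((hP _).2 trivial) ((hR _ _).2 ?_) hxI)
    exact separationOrder_even_odd.2
      ⟨l, hl, hml.trans' (num_le_add_right _ _), s, hml.trans' (num_le_add_left _ _), hs⟩
  · intro h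
    have : BddDef (fun e : M.Env => b m (e 0)) := hb (fun _ => m) fun e => e 0
    -- An entry records the first stage, so this `s` gives an odd number strictly below `m + m`.
    obtain ⟨s, hs, hmin⟩ := exists_least (b m) h
    intro hmX
    exact hID _ (hDodd (M.pair m s)) _ ((hX m).1 hmX)
      ⟨(hR _ _).2 (separationOrder_odd_even.2 ⟨s, right_le_pair _ _, rfl, hs, hmin⟩),
        double_ne_double_add_one.symm⟩

/-! ### From separation to weak König's lemma -/

theorem IsBinSeq.mem_of_subset {r t n l i b : M.Num} (hr : M.IsBinSeq r n) (ht : M.IsBinSeq t l)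
    (h : M.finSet r ⊆ M.finSet t) (hi : i < n) (hb : M.pair i b ∈ M.finSet t) :
    M.pair i b ∈ M.finSet r := by
  obtain ⟨c, hc, -⟩ := hr.value i hi
  obtain ⟨d, -, hd⟩ := ht.value i (ht.lt_length hb)
  rwa [hd b hb, ← hd c (h hc)]

theorem IsBinSeq.subset_of_subset {s r t l n m : M.Num} (hs : M.IsBinSeq s l)
    (hr : M.IsBinSeq r n) (ht : M.IsBinSeq t m) (hst : M.finSet s ⊆ M.finSet t)
    (hrt : M.finSet r ⊆ M.finSet t) (hln : l ≤ n) : M.finSet s ⊆ M.finSet r := by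
  intro x hx
  obtain ⟨i, b, rfl, hi, -⟩ := hs.mem x hx
  exact hr.mem_of_subset ht hrt (hi.trans_le hln) (hst hx)

/-- This is why the restriction `r ≤ s` in `Follows` is harmless, which keeps that notion bounded.
-/
theorem IsBinSeq.code_le_of_subset {r t n l : M.Num} (hr : M.IsBinSeq r n) (ht : M.IsBinSeq t l)
    (h : M.finSet r ⊆ M.finSet t) : r ≤ t := by
  obtain ⟨hnl, hb⟩ := (hr.subset_iff ht).1 h
  obtain ⟨r', hr't, hr', h'⟩ := ht.exists_restrict hnl
  rwa [hr.ext hr' fun i hi => (hb i hi).trans (((hr'.subset_iff ht).1 h').2 i hi).symm]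

/-- Below `B`, the tree `T` has a sequence of length `n` which extends `s` and has value `c` at
`l`. -/
def ExtendsWith (T : Set M.Num) (s l c n B : M.Num) : Prop :=
  ∃ t, t < B ∧ (t ∈ T ∧ M.IsBinSeq t n ∧ M.finSet s ⊆ M.finSet t ∧ M.pair l c ∈ M.finSet t)

/-- `B` shows that at some level, the extensions of `s` in `T` by `c` have died out while those by
`d` have not. -/
def DiesFirst (T : Set M.Num) (c d s B : M.Num) : Prop :=
  ∃ l, l ≤ s ∧ (M.IsBinSeq s l ∧ ∃ n, n < B ∧
    (l < n ∧ IsSeqBound n B ∧ ¬ ExtendsWith T s l c n B ∧ ExtendsWith T s l d n B))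

theorem bddDef_diesFirst (T : Set M.Num) [Fact (T ∈ M.sets)] (c d : M.Num)
    (f g : M.Env → M.Num) [TermDef f] [TermDef g] :
    BddDef (fun e : M.Env => DiesFirst T c d (f e) (g e)) := by
  unfold DiesFirst ExtendsWith
  infer_instance

theorem ExtendsWith.restrict {T : Set M.Num} (hT : M.IsBinTree T) {s l c m n B C : M.Num}
    (hs : M.IsBinSeq s l) (hln : l < n) (hnm : n ≤ m) (hB : IsSeqBound n B)
    (h : ExtendsWith T s l c m C) : ExtendsWith T s l c n B := by
  obtain ⟨t, -, htT, ht, hst, hc⟩ := h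
  obtain ⟨r, -, hr, hrt⟩ := ht.exists_restrict hnm
  exact ⟨r, hB.code_lt hr le_rfl, hT.closed r t n htT hr hrt, hr,
    hs.subset_of_subset hr ht hst hrt hln.le, hr.mem_of_subset ht hrt hln hc⟩

/-- Extensions restrict to lower levels, so dying out is permanent. At the lower of the two levels,
one of the two continuations would be both extinct and alive. -/
theorem DiesFirst.asymm {T : Set M.Num} (hT : M.IsBinTree T) {c d s B C : M.Num}
    (h : DiesFirst T c d s B) : ¬ DiesFirst T d c s C := by
  obtain ⟨l, -, hs, n, -, hln, hB, hc, hd⟩ := h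
  rintro ⟨l', -, hs', m, -, hlm, hC, hd', hc'⟩
  obtain rfl := hs.length_unique hs'
  rcases le_total n m with h | h
  · exact hc (hc'.restrict hT hs hln h hB)
  · exact hd' (hd.restrict hT hs hlm h hC)

/-- The sequence `s` of length `l` follows the instruction to continue a sequence by `1` if its code
is in `X`, and by `0` otherwise. -/
def Follows (X : Set M.Num) (s l : M.Num) : Prop :=
  M.IsBinSeq s l ∧ ∀ i, i < l → ∀ r, r ≤ s → M.IsBinSeq r i → M.finSet r ⊆ M.finSet s →
    (M.pair i 1 ∈ M.finSet s ↔ r ∈ X)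

instance BddDef.follows (X : Set M.Num) [Fact (X ∈ M.sets)] (f g : M.Env → M.Num) [TermDef f]
    [TermDef g] : BddDef (fun e : M.Env => Follows X (f e) (g e)) := by
  unfold Follows
  infer_instance

section

variable {X : Set M.Num} {s t l m n r i : M.Num}

theorem Follows.iff (h : Follows X s l) (hi : i < l) (hr : M.IsBinSeq r i)
    (hrs : M.finSet r ⊆ M.finSet s) : M.pair i 1 ∈ M.finSet s ↔ r ∈ X :=
  h.2 i hi r (hr.code_le_of_subset h.1 hrs) hr hrs

theorem Follows.restrict (h : Follows X s l) (hr : M.IsBinSeq r n)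
    (hrs : M.finSet r ⊆ M.finSet s) : Follows X r n := by
  obtain ⟨hnl, hb⟩ := (hr.subset_iff h.1).1 hrs
  exact ⟨hr, fun i hi r' _ hr' hrr' =>
    (hb i hi).trans (h.iff (hi.trans_le hnl) hr' (hrr'.trans hrs))⟩

/-- If all earlier bits agree, the restrictions to length `i` are the same sequence with the same
code, so `X` prescribes the same bit. -/
theorem Follows.agree (hs : Follows X s l) (ht : Follows X t m) (hil : i < l) (him : i < m) :
    M.pair i 1 ∈ M.finSet s ↔ M.pair i 1 ∈ M.finSet t := by
  revert hil him
  refine strong_induct (fun i : M.Num => i < l → i < m →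
    (M.pair i 1 ∈ M.finSet s ↔ M.pair i 1 ∈ M.finSet t)) (fun i ih hil him => ?_) i
  obtain ⟨r, -, hr, hrs⟩ := hs.1.exists_restrict hil.le
  obtain ⟨r', -, hr', hrt⟩ := ht.1.exists_restrict him.le
  have : r = r' := hr.ext hr' fun j hj => by
    rw [((hr.subset_iff hs.1).1 hrs).2 j hj, ((hr'.subset_iff ht.1).1 hrt).2 j hj]
    exact ih j hj (hj.trans hil) (hj.trans him)
  subst this
  rw [hs.iff hil hr hrs, ht.iff him hr hrt]

theorem Follows.agree' (hs : Follows X s l) (ht : Follows X t m) (him : i < m) {b : M.Num}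
    (hb : M.pair i b ∈ M.finSet s) : M.pair i b ∈ M.finSet t := by
  have hil := hs.1.lt_length hb
  have key := hs.agree ht hil him
  obtain ⟨j, c, hjc, -, hc⟩ := hs.1.mem _ hb
  obtain ⟨rfl, rfl⟩ := pair_inj hjc
  obtain rfl | rfl := hc
  · rw [ht.1.pair_zero_mem him, ← key, ← hs.1.pair_zero_mem hil]
    exact hb
  · exact key.1 hb

theorem exists_follows (X : Set M.Num) [hX : Fact (X ∈ M.sets)] (n : M.Num) :
    ∃ s, Follows X s n := by
  refine induct (fun n : M.Num => ∃ s, Follows X s n) ?_ (fun n ih => ?_) n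
  · obtain ⟨s, hs, -⟩ := exists_isBinSeq (0 : M.Num) (fun _ => True)
    exact ⟨s, hs, fun i hi => absurd hi (Arith.basic.not_lt_zero i)⟩
  · obtain ⟨s, hs⟩ := ih
    obtain ⟨t, ht, hb⟩ := exists_isBinSeq (n + 1)
      (fun i : M.Num => i < n ∧ M.pair i 1 ∈ M.finSet s ∨ i = n ∧ s ∈ X)
    have hbs : ∀ i, i < n → (M.pair i 1 ∈ M.finSet s ↔ M.pair i 1 ∈ M.finSet t) := fun i hi => by
      rw [hb i (hi.trans (lt_add_one' n))]
      simp [hi, hi.ne]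
    have hst : M.finSet s ⊆ M.finSet t := (hs.1.subset_iff ht).2 ⟨(lt_add_one' n).le, hbs⟩
    refine ⟨t, ht, fun i hi r _ hr hrt => ?_⟩
    have hin := (lt_add_one_iff' _ _).1 hi
    have hrs := hr.subset_of_subset hs.1 ht hrt hst hin
    obtain rfl | hin := hin.eq_or_lt
    · obtain rfl := hr.ext hs.1 ((hr.subset_iff hs.1).1 hrs).2
      rw [hb i hi]
      simp
    · rw [← hbs i hin]
      exact hs.iff hin hr hrs

theorem exists_isBinFunction_of_follows (X : Set M.Num) [hX : Fact (X ∈ M.sets)] :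
    ∃ F, M.IsBinFunction F ∧ ∀ s n, Follows X s n →
      ∀ i b, i < n → (M.pair i b ∈ M.finSet s ↔ M.pair i b ∈ F) := by
  -- `F` is the union of all sequences which follow `X`. Its complement is `Σ⁰₁` too: either `x` is
  -- not a pair with second entry `0` or `1`, or a sequence following `X` takes the opposite value.
  have hco : ∀ x : M.Num, (¬ ∃ s l, Follows X s l ∧ x ∈ M.finSet s) ↔
      (∀ i, i ≤ x → ¬ (x = M.pair i 0 ∨ x = M.pair i 1)) ∨
        ∃ s l, Follows X s l ∧ ∃ i, i < l ∧ ((x = M.pair i 0 ∧ M.pair i 1 ∈ M.finSet s) ∨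
          (x = M.pair i 1 ∧ M.pair i 0 ∈ M.finSet s)) := by
    intro x
    constructor
    · intro h
      by_contra! h'
      obtain ⟨⟨i, -, hx⟩, h'⟩ := h'
      obtain ⟨s, hs⟩ := exists_follows X (i + 1)
      have hi := hs.1.pair_zero_mem (lt_add_one' i)
      have hx' : x ∉ M.finSet s := fun hx => h ⟨s, _, hs, hx⟩
      obtain ⟨h0, h1⟩ := h' s _ hs i (lt_add_one' i)
      obtain rfl | rfl := hx
      · exact h0 rfl (by tauto)
      · exact h1 rfl (by tauto)
    · rintro (h | ⟨s, l, hs, i, hi, h⟩) ⟨t, m, ht, hx⟩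
      · obtain ⟨j, b, rfl, -, hb⟩ := ht.1.mem x hx
        exact h j (left_le_pair _ _) (by obtain rfl | rfl := hb <;> simp)
      · have h0 := hs.1.pair_zero_mem hi
        obtain ⟨rfl, h1⟩ | ⟨rfl, h1⟩ := h
        · exact h0.1 (ht.agree' hs hi hx) h1
        · exact h0.1 h1 (ht.agree' hs hi hx)
  have hneg : SigmaDef (fun e : M.Env => ¬ ∃ s l, Follows X s l ∧ e 0 ∈ M.finSet s) := by
    simp only [hco]
    infer_instance
  obtain ⟨F, hF, hmem⟩ := exists_set (fun x : M.Num => ∃ s l, Follows X s l ∧ x ∈ M.finSet s)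
  have key : ∀ s n, Follows X s n →
      ∀ i b, i < n → (M.pair i b ∈ M.finSet s ↔ M.pair i b ∈ F) := by
    intro s n hs i b hi
    rw [hmem]
    exact ⟨fun h => ⟨s, n, hs, h⟩, fun ⟨t, m, ht, h⟩ => ht.agree' hs hi h⟩
  refine ⟨F, ⟨hF, fun x hx => ?_, fun i => ?_⟩, key⟩
  · obtain ⟨s, l, hs, hx⟩ := (hmem x).1 hx
    obtain ⟨i, b, h, -, hb⟩ := hs.1.mem x hx
    exact ⟨i, b, h, hb⟩
  · obtain ⟨s, hs⟩ := exists_follows X (i + 1)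
    have := hs.1.value i (lt_add_one' i)
    simpa only [key s _ hs i _ (lt_add_one' i)] using this

end

/-- Infinity of `T` means unbounded codes. A code above all codes of sequences of length at most `n`
belongs to a longer sequence, which can be cut to length `n`. -/
theorem IsBinTree.exists_length {T : Set M.Num} (hT : M.IsBinTree T) (hinf : M.IsInfinite T)
    (n : M.Num) : ∃ t ∈ T, M.IsBinSeq t n := by
  obtain ⟨B, hB⟩ := exists_isSeqBound n
  obtain ⟨t, htT, hBt⟩ := hinf B
  obtain ⟨l, ht⟩ := hT.seq t htT
  have hnl : n ≤ l := by
    by_contra! h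
    exact lt_asymm hBt (hB.code_lt ht h.le)
  obtain ⟨r, -, hr, hrt⟩ := ht.exists_restrict hnl
  exact ⟨r, hT.closed r t n htT hr hrt, hr⟩

/-- If `X` separates the sequences whose extensions by `0` die first from those whose extensions by
`1` die first, then the sequences which follow `X` have extensions of all lengths. -/
theorem Follows.exists_extension {T X : Set M.Num} (hT : M.IsBinTree T) (hinf : M.IsInfinite T)
    [hX : Fact (X ∈ M.sets)]
    (hX0 : ∀ s, (∃ B, DiesFirst T 0 1 s B) → s ∈ X) (hX1 : ∀ s, (∃ B, DiesFirst T 1 0 s B) → s ∉ X)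
    {s n m B : M.Num} (hs : Follows X s n) (hnm : n ≤ m) (hB : IsSeqBound m B) :
    ∃ t, t < B ∧ (t ∈ T ∧ M.IsBinSeq t m ∧ M.finSet s ⊆ M.finSet t) := by
  have := Fact.mk hT.isSet
  revert s m B
  suffices h : ∀ s m B, Follows X s n ∧ n ≤ m ∧ IsSeqBound m B →
      ∃ t, t < B ∧ (t ∈ T ∧ M.IsBinSeq t m ∧ M.finSet s ⊆ M.finSet t) from
    fun {s m B} hs hnm hB => h s m B ⟨hs, hnm, hB⟩
  -- The bound `B` on codes of length `m` makes the quantifier over `t` bounded, so the statement is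
  -- `Π⁰₁` in the length of `s`.
  have hp : SigmaDef (fun e : M.Env => ¬ ∀ s m B, Follows X s (e 0) ∧ e 0 ≤ m ∧ IsSeqBound m B →
      ∃ t, t < B ∧ (t ∈ T ∧ M.IsBinSeq t m ∧ M.finSet s ⊆ M.finSet t)) := by
    simp only [not_forall, exists_prop]
    infer_instance
  refine induct_pi (fun n : M.Num => ∀ s m B, Follows X s n ∧ n ≤ m ∧ IsSeqBound m B →
      ∃ t, t < B ∧ (t ∈ T ∧ M.IsBinSeq t m ∧ M.finSet s ⊆ M.finSet t)) ?_ (fun n ih => ?_) n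
  · rintro s m B ⟨hs, -, hB⟩
    obtain ⟨t, htT, ht⟩ := hT.exists_length hinf m
    exact ⟨t, hB.code_lt ht le_rfl, htT, ht, (hs.1.subset_iff ht).2
      ⟨num_nonneg m, fun i hi => absurd hi (Arith.basic.not_lt_zero i)⟩⟩
  · rintro s m B ⟨hs, hnm, hB⟩
    rw [add_one_le_iff'] at hnm
    obtain ⟨r, -, hr, hrs⟩ := hs.1.exists_restrict (lt_add_one' n).le
    obtain ⟨t, htB, htT, ht, hrt⟩ := ih r m B ⟨hs.restrict hr hrs, hnm.le, hB⟩
    have hiff := hs.iff (lt_add_one' n) hr hrs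
    have hr0 := hs.1.pair_zero_mem (lt_add_one' n)
    have hsub : ∀ b u, M.pair n b ∈ M.finSet s → M.IsBinSeq u m → M.finSet r ⊆ M.finSet u →
        M.pair n b ∈ M.finSet u → M.finSet s ⊆ M.finSet u := by
      intro b u hbs hu hru hbu x hx
      obtain ⟨i, c, rfl, hi, -⟩ := hs.1.mem x hx
      obtain rfl | hi := ((lt_add_one_iff' _ _).1 hi).eq_or_lt
      · obtain ⟨d, -, hd⟩ := hs.1.value i (lt_add_one' i)
        rwa [hd c hx, ← hd b hbs]
      · exact hru (hr.mem_of_subset hs.1 hrs hi hx)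
    have hfin : ∀ b, M.pair n b ∈ M.finSet s → ExtendsWith T r n b m B →
        ∃ t, t < B ∧ (t ∈ T ∧ M.IsBinSeq t m ∧ M.finSet s ⊆ M.finSet t) :=
      fun b hbs ⟨u, huB, huT, hu, hru, hbu⟩ => ⟨u, huB, huT, hu, hsub b u hbs hu hru hbu⟩
    -- The extension `t` of `r` has some bit at position `n`. If `s` continued `r` by a bit without
    -- extensions of length `m`, then that bit has died first, and `X` would have prescribed the
    -- other one.
    have hsome : ExtendsWith T r n 0 m B ∨ ExtendsWith T r n 1 m B := by
      by_cases h1 : M.pair n 1 ∈ M.finSet t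
      · exact .inr ⟨t, htB, htT, ht, hrt, h1⟩
      · exact .inl ⟨t, htB, htT, ht, hrt, (ht.pair_zero_mem hnm).2 h1⟩
    have hdies : ∀ c d, ¬ ExtendsWith T r n c m B → ExtendsWith T r n d m B →
        ∃ B, DiesFirst T c d r B := fun c d hc hd =>
      ⟨B, n, hr.length_le, hr, m, hB.lt, hnm, hB, hc, hd⟩
    by_cases h1 : M.pair n 1 ∈ M.finSet s
    · refine hfin 1 h1 (by_contra fun h => ?_)
      exact hX1 r (hdies 1 0 h (hsome.resolve_right h)) (hiff.1 h1)
    · refine hfin 0 (hr0.2 h1) (by_contra fun h => ?_)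
      exact h1 (hiff.2 (hX0 r (hdies 0 1 h (hsome.resolve_left h))))

theorem weakKonig_of_exists_initialInterval
    (h3 : ∀ P R D : Set M.Num, M.IsPartialOrder P R → M.IsAntichain P R D → M.IsInfinite D →
      ∃ I : Set M.Num, M.IsInitialInterval P R I ∧ M.IsInfinite (I ∩ D) ∧
        ∀ x ∈ D, ∀ y ∈ I, ¬ M.StrictlyBelow R x y) :
    M.WeakKonig := by
  intro T hT hinf
  have := Fact.mk hT.isSet
  obtain ⟨X, hXs, hX⟩ := exists_separating_set h3 (DiesFirst T 0 1) (DiesFirst T 1 0)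
    (fun f g _ _ => bddDef_diesFirst T 0 1 f g) (fun f g _ _ => bddDef_diesFirst T 1 0 f g)
    fun _ _ _ h => h.asymm hT
  have := Fact.mk hXs
  obtain ⟨F, hF, h⟩ := exists_isBinFunction_of_follows X
  refine ⟨F, hF, fun n => ?_⟩
  obtain ⟨s, hs⟩ := exists_follows X n
  obtain ⟨B, hB⟩ := exists_isSeqBound n
  obtain ⟨t, -, htT, ht, hst⟩ :=
    hs.exists_extension hT hinf (fun s => (hX s).1) (fun s => (hX s).2) le_rfl hB
  exact ⟨s, hT.closed s t n htT hs.1 hst, hs.1, h s n hs⟩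

end L2Structure

/-- Over `RCA₀` (that is, in every model of `RCA₀`) the three statements are equivalent. -/
theorem lemma5p7 (M : L2Structure.{u}) (hM : M.RCA0) :
    List.TFAE [
      M.WKL0,
      ∀ P R D : Set M.Num, M.IsPartialOrder P R → M.IsAntichain P R D → M.IsInfinite D →
        ∃ I : Set M.Num, M.IsInitialInterval P R I ∧ D ⊆ I ∧
          ∀ x ∈ D, ∀ y ∈ I, ¬ M.StrictlyBelow R x y,
      ∀ P R D : Set M.Num, M.IsPartialOrder P R → M.IsAntichain P R D → M.IsInfinite D →
        ∃ I : Set M.Num, M.IsInitialInterval P R I ∧ M.IsInfinite (I ∩ D) ∧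
          ∀ x ∈ D, ∀ y ∈ I, ¬ M.StrictlyBelow R x y] := by
  have := Fact.mk hM
  tfae_have 1 → 2 := fun h P R D hP hD _ => h.2.exists_initialInterval hP hD
  tfae_have 2 → 3 := fun h P R D hP hD hinf => by
    obtain ⟨I, hI, hDI, hlt⟩ := h P R D hP hD hinf
    exact ⟨I, hI, by rwa [Set.inter_eq_self_of_subset_right hDI], hlt⟩
  tfae_have 3 → 1 := fun h => ⟨hM, L2Structure.weakKonig_of_exists_initialInterval h⟩
  tfae_finish
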